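/- **Setting.** Let $R\subset\mathbb{R}^s$ ($s\ge 1$) be a bounded Borel set of positive Lebesgue measure. Let $\beta=(\beta_1,\dots,\beta_p)^T$ be a vector of bounded measurable functions on $R$ that are linearly independent modulo Lebesgue null sets (for example a B-spline or tensor-product B-spline basis). For $q\ge 0$ let $b(t)=(t-1,(t-1)^2,\dots,(t-1)^q)^T$. For integers $r,t\ge1$ let $\{t\}_r\in\{1,\dots,r\}$ be the remainder of $t$ modulo $r$, with $\{t\}_r=r$ if $r\mid t$. Let $d\ge 1$ be the seasonal period, let $r$ be a multiple of $d$ with $q<r$, and write $j(t)=\{t\}_d$. If a linear combination of $\beta_1,\dots,\beta_p$ equals $1$ almost everywhere on $R$ (as for B-splines), suppose moreover that $q\le r-d$. **Assumptions.** - (A1) $X_1,X_2,\dots$ are finite point processes on $R$ and $\Lambda_1,\Lambda_2,\dots$ are random intensity functions on $R$ such that, for every $n$, conditionally on $\Lambda_1,\dots,\Lambda_n$ the processes $X_1,\dots,X_n$ are independent and each $X_t$ is a Poisson process with intensity function $\Lambda_t$. - (A2) $\log\Lambda_t(u)=\mu(u,t)+Y_t(u)$, where $\{Y_t(u): t\ge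 1,\ u\in R\}$ is a zero-mean Gaussian process, each $Y_t$ being jointly measurable in $u$ and the sample point, stationary in $t$ with autocovariance functions $\gamma_k(u,u')=\mathrm{cov}\{Y_t(u),Y_{t+k}(u')\}$. - (A3) $\mu(u,t)=\mu_{0j(t)}(u)+\tilde c_0(\{t\}_r)$ with $\mu_{0j}(u)=\theta_{0j}^T\beta(u)$, $\theta_{0j}\in\mathbb{R}^p$ for $j=1,\dots,d$, and $\tilde c_0(t)=\eta_0^Tb(t)$, $\eta_0\in\mathbb{R}^q$. - (A4) $v_0(u)=\mathrm{var}\{Y_t(u)\}=\tau_0^T\beta(u)$ for all $u\in R$, for some $\tau_0\in\mathbb{R}^p$. - (A5) $\lim_{k\to\infty}\sup_{u,u'\in R}|\gamma_k(u,u')|=0$. No independence of the $Y_t$ is assumed. **Estimators.** Write $X_t=\{u_{t1},\dots,u_{tm_t}\}$, and let $(\hat\theta_1,\dots,\hat\theta_d,\hat\eta)$ be a maximizer over $(\mathbb{R}^p)^d\times\mathbb{R}^q$ of the working log-likelihood $$\rho_n(\theta_1,\dots,\theta_d,\eta)=-\frac1n\sum_{t=1}^n e^{\eta^Tb(\{t\}_r)}\int_R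 e^{\theta_{j(t)}^T\beta(u)}\,du+\frac1n\sum_{t=1}^n m_t\,\eta^Tb(\{t\}_r)+\frac1n\sum_{t=1}^n\sum_{k=1}^{m_t}\theta_{j(t)}^T\beta(u_{tk})$$ (chosen arbitrarily if $\rho_n$ has no maximizer). **Theorem.** As $n\to\infty$, in probability, $$\hat\eta\to\eta_0\qquad\text{and}\qquad\hat\theta_j\to\theta_{0j}+\tau_0/2\quad(j=1,\dots,d).$$ Consequently $\hat\eta^Tb(t)\to\tilde c_0(t)$ in probability for every $t\in[1,r]$, and $\hat\lambda_j(u)=\exp\{\hat\theta_j^T\beta(u)\}\to\lambda_{0j}(u)=\exp\{\mu_{0j}(u)+v_0(u)/2\}$ in probability for every $u\in R$ and $j=1,\dots,d$. -/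

import Mathlib

open MeasureTheory ProbabilityTheory Filter Topology
open scoped ENNReal NNReal

noncomputable section

namespace PointSeries

/-- The residue `{t}_r ∈ {1, …, r}`: the remainder of `t` modulo `r` if it is positive, and `r`
if `t` is a multiple of `r` (for `r ≥ 1`). -/
def residue (r t : ℕ) : ℕ := if t % r = 0 then r else t % r

theorem residue_mem (r t : ℕ) (hr : 0 < r) : residue r t ∈ Finset.Icc 1 r := by
  have h := Nat.mod_lt t hr
  unfold residue
  rw [Finset.mem_Icc]
  split_ifs <;> omega

/-- The seasons `1, …, d`. -/
abbrev Season (d : ℕ) : Type := Finset.Icc 1 d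

/-- The season `j(t) = {t}_d` of time `t`. -/
def season (d : ℕ) [NeZero d] (t : ℕ) : Season d :=
  ⟨residue d t, residue_mem d t (Nat.pos_of_ne_zero (NeZero.ne d))⟩

/-- The vector `b(t) = (t - 1, (t - 1)², …, (t - 1)^q)` of monomials centred at `1`. -/
def trendBasis (q : ℕ) (t : ℝ) : Fin q → ℝ := fun k => (t - 1) ^ (k.val + 1)

/-- The parameters `((θ₁, …, θ_d), η)` of the trend-plus-seasonality model. -/
abbrev Param (d p q : ℕ) : Type := (Season d → Fin p → ℝ) × (Fin q → ℝ)

/-- The mean function `μ(u, t) = μ_{j(t)}(u) + c(t)` with `μ_j(u) = θ_jᵀ β(u)` and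
`c(t) = ηᵀ b({t}_r)`. -/
def meanFn {E : Type*} {d p q : ℕ} [NeZero d] (r : ℕ) (β : E → Fin p → ℝ) (ϑ : Param d p q)
    (t : ℕ) (u : E) : ℝ :=
  ϑ.1 (season d t) ⬝ᵥ β u + ϑ.2 ⬝ᵥ trendBasis q (residue r t)

/-- The log-Gaussian random intensities `Λ_t(u) = exp (μ(u, t) + Y_t(u))`. -/
def intensity {E Ω : Type*} {d p q : ℕ} [NeZero d] (r : ℕ) (β : E → Fin p → ℝ) (ϑ : Param d p q)
    (Y : ℕ → E → Ω → ℝ) (t : ℕ) (u : E) (ω : Ω) : ℝ :=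
  Real.exp (meanFn r β ϑ t u + Y t u ω)

/-- The count `N(B) = #(x ∩ B)` of a finite point pattern `x`. -/
def count {E : Type*} (x : Finset E) (B : Set E) : ℕ := ((x : Set E) ∩ B).ncard

/-- The probability that a Poisson process with intensity function `lam` has exactly `m i` points
in `B i` for every `i`, where the sets `B i` are pairwise disjoint: the counts are independent,
and the `i`-th one is Poisson distributed with rate `∫_{B i} lam`. -/
def poissonCountProb {E : Type*} [MeasureSpace E] {k : ℕ} (lam : E → ℝ) (B : Fin k → Set E)
    (m : Fin k → ℕ) : ℝ :=
  ∏ i, (poissonMeasure (∫ u in B i, lam u).toNNReal).real {m i}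

/-- The `σ`-algebra generated by the random intensities `Λ_1, …, Λ_n` on `R`. -/
abbrev latentSigma {E Ω : Type*} (R : Set E) (Λ : ℕ → E → Ω → ℝ) (n : ℕ) : MeasurableSpace Ω :=
  ⨆ t ∈ Finset.Icc 1 n, ⨆ u ∈ R, MeasurableSpace.comap (Λ t u) inferInstance

/-- `X_1, X_2, …` are finite point processes on `R` such that, for every `n`, conditionally on
`Λ_1, …, Λ_n` the processes `X_1, …, X_n` are independent and each `X_t` is a Poisson process with
intensity function `Λ_t`. The conditional law is described by the joint conditional distribution of
the counts in disjoint measurable subsets of `R`. -/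
structure IsCoxSeries {E Ω : Type*} [MeasureSpace E] [MeasurableSpace Ω] (P : Measure Ω)
    (R : Set E) (Λ : ℕ → E → Ω → ℝ) (X : ℕ → Ω → Finset E) : Prop where
  subset : ∀ t, 1 ≤ t → ∀ ω, (X t ω : Set E) ⊆ R
  measurable_count : ∀ t, 1 ≤ t → ∀ B, MeasurableSet B → Measurable fun ω => count (X t ω) B
  condLaw : ∀ (n k : ℕ) (B : ℕ → Fin k → Set E) (m : ℕ → Fin k → ℕ),
    (∀ t i, MeasurableSet (B t i)) → (∀ t i, B t i ⊆ R) →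
    (∀ t i i', i ≠ i' → Disjoint (B t i) (B t i')) →
    P⟦{ω | ∀ t ∈ Finset.Icc 1 n, ∀ i, count (X t ω) (B t i) = m t i} | latentSigma R Λ n⟧
      =ᵐ[P] fun ω => ∏ t ∈ Finset.Icc 1 n, poissonCountProb (fun u => Λ t u ω) (B t) (m t)

/-- `Y_1, Y_2, …` are measurable zero-mean jointly Gaussian processes on `R`, stationary in time,
with autocovariance functions `γ_k(u, u') = cov (Y_t(u), Y_{t+k}(u'))`, `k ≥ 0` (those with negative
`k` are `γ_{-k}(u, u') = γ_k(u', u)`). -/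
structure IsStationaryGaussianSeries {E Ω : Type*} [MeasurableSpace E] [MeasurableSpace Ω]
    (P : Measure Ω) (R : Set E) (Y : ℕ → E → Ω → ℝ) (γ : ℕ → E → E → ℝ) : Prop where
  measurable : ∀ t, 1 ≤ t → Measurable fun z : R × Ω => Y t z.1 z.2
  gaussian : IsGaussianProcess (fun (i : {t : ℕ // 1 ≤ t} × R) (ω : Ω) => Y i.1 i.2 ω) P
  mean_zero : ∀ t, 1 ≤ t → ∀ u ∈ R, ∫ ω, Y t u ω ∂P = 0
  autocov : ∀ t, 1 ≤ t → ∀ k, ∀ u ∈ R, ∀ u' ∈ R, cov[Y t u, Y (t + k) u'; P] = γ k u u'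

/-- The working log-likelihood `ρ_n(θ₁, …, θ_d, η)` (up to terms that do not depend on the
parameters, and divided by `n`) of the point patterns `x_1, …, x_n`. -/
def rho {E : Type*} [MeasureSpace E] {d p q : ℕ} [NeZero d] (r : ℕ) (R : Set E)
    (β : E → Fin p → ℝ) (n : ℕ) (x : ℕ → Finset E) (ϑ : Param d p q) : ℝ :=
  -((1 / (n : ℝ)) * ∑ t ∈ Finset.Icc 1 n, (Real.exp (ϑ.2 ⬝ᵥ trendBasis q (residue r t)) *
      (∫ u in R, Real.exp (ϑ.1 (season d t) ⬝ᵥ β u))))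
    + (1 / (n : ℝ)) * (∑ t ∈ Finset.Icc 1 n,
        ((x t).card : ℝ) * (ϑ.2 ⬝ᵥ trendBasis q (residue r t)))
    + (1 / (n : ℝ)) * (∑ t ∈ Finset.Icc 1 n, ∑ u ∈ x t, (ϑ.1 (season d t) ⬝ᵥ β u))

/-- `est n` is an M-estimator from `X_1, …, X_n`: it maximizes `ρ_n` over the whole parameter space
whenever `ρ_n` has a maximizer, and is arbitrary otherwise (for instance when there are no points
at all, in which case no maximizer need exist). -/
def IsMEstimator {E Ω : Type*} [MeasureSpace E] {d p q : ℕ} [NeZero d] (r : ℕ) (R : Set E)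
    (β : E → Fin p → ℝ) (X : ℕ → Ω → Finset E) (est : ℕ → Ω → Param d p q) : Prop :=
  ∀ n, 1 ≤ n → ∀ ω, (∃ ϑ : Param d p q, IsMaxOn (rho r R β n fun t => X t ω) Set.univ ϑ) →
    IsMaxOn (rho r R β n fun t => X t ω) Set.univ (est n ω)

end PointSeries

end

/-! For a centred Gaussian Z, E exp(c + Z) = exp(c + Var Z / 2), so the mean intensity is exp(μ +
v₀/2). Since v₀ = τ₀ᵀβ, this is again of the model's form, with parameter ϑ* = ((θ₀ⱼ + τ₀/2)ⱼ, η₀).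
The working Poisson likelihood is therefore correctly specified for the mean, and that is all that
consistency needs.

For every shift h, `rho_add_sub_rho` splits ρ_n(ϑ* + h) - ρ_n(ϑ*) exactly into a noise term minus an
average excess. The noise is linear in h, and its finitely many coefficients are weighted, centred
averages over the points. The excess is deterministic, periodic in time and nonnegative, because exp
x ≥ 1 + x.

The noise vanishes by a weak law. Given the intensities, counts at distinct times are independent
Poisson variables, and a mixed log-Gaussian moment is the product of the means times
exp(covariance). Under (A5) the covariances of the counts are thus bounded and tend to zero
uniformly with the lag. Chebyshev's inequality gives the law for counts in a set, and simple
functions extend it to sums of bounded functions (`IsLogGaussianCoxSeries.tendstoInMeasure_sum`).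

The excess summed over a period vanishes only at h = 0. Equality in exp x ≥ 1 + x forces the mean
function of h to vanish almost everywhere, and `eq_zero_of_ae_meanFn_eq_zero` then gives h = 0 by
counting zeros of the trend polynomial. Compactness makes the sum bounded below on each sphere
(`exists_pos_le_sum_excess`).

So, with probability tending to one, ρ_n is smaller on the whole ε-sphere around ϑ* than at ϑ*. By
concavity a maximizer then exists and every maximizer lies within ε of ϑ*. Linearity of the noise
and concavity replace a uniform law of large numbers and a compact parameter space. -/

noncomputable section

namespace PointSeries

set_option linter.unusedSectionVars false

/-! ### Moments of the Poisson distribution -/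

section Poisson

/-- This recursion turns each factor of n in a moment sum into a shift of the index, which yields
the first two moments. -/
theorem poissonMeasure_singleton_succ_mul (r : ℝ≥0) (n : ℕ) :
    poissonMeasure r {n + 1} * ((n + 1 : ℕ) : ℝ≥0∞) = r * poissonMeasure r {n} := by
  rw [poissonMeasure_singleton, poissonMeasure_singleton, ← ENNReal.ofReal_natCast,
    ← ENNReal.ofReal_mul (by positivity), ← ENNReal.ofReal_coe_nnreal,
    ← ENNReal.ofReal_mul (by positivity)]
  congr 1
  rw [Nat.factorial_succ]
  push_cast
  field_simp
  ring

theorem tsum_poissonMeasure_singleton (r : ℝ≥0) : ∑' n, poissonMeasure r {n} = 1 := by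
  have h := lintegral_countable' (μ := poissonMeasure r) (fun _ => 1)
  simpa using h.symm

theorem tsum_mul_poissonMeasure_singleton (r : ℝ≥0) :
    ∑' n : ℕ, (n : ℝ≥0∞) * poissonMeasure r {n} = r := by
  rw [tsum_eq_zero_add' ENNReal.summable]
  simp_rw [mul_comm (Nat.cast _ : ℝ≥0∞), poissonMeasure_singleton_succ_mul]
  rw [ENNReal.tsum_mul_left, tsum_poissonMeasure_singleton]
  simp

theorem tsum_sq_mul_poissonMeasure_singleton (r : ℝ≥0) :
    ∑' n : ℕ, (n : ℝ≥0∞) ^ 2 * poissonMeasure r {n} = r + (r : ℝ≥0∞) ^ 2 := by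
  rw [tsum_eq_zero_add' ENNReal.summable]
  have h : ∀ n : ℕ, ((n + 1 : ℕ) : ℝ≥0∞) ^ 2 * poissonMeasure r {n + 1} =
      r * ((n : ℝ≥0∞) * poissonMeasure r {n} + poissonMeasure r {n}) := by
    intro n
    rw [sq, mul_assoc, mul_comm (Nat.cast _ : ℝ≥0∞) (poissonMeasure r {n + 1}),
      poissonMeasure_singleton_succ_mul]
    push_cast
    ring
  simp_rw [h]
  rw [ENNReal.tsum_mul_left, ENNReal.tsum_add, tsum_poissonMeasure_singleton,
    tsum_mul_poissonMeasure_singleton]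
  simp
  ring

theorem measurable_poissonMeasure_singleton (n : ℕ) :
    Measurable fun r : ℝ≥0 => poissonMeasure r {n} := by
  simp_rw [poissonMeasure_singleton]
  fun_prop

end Poisson

/-! ### Moments of the counts of a Cox series -/

theorem count_empty {E : Type*} (x : Finset E) : count x ∅ = 0 := by simp [count]

section Cox

variable {E Ω : Type*} [MeasureSpace E] [MeasurableSpace Ω] {P : Measure Ω}
  {R B : Set E} {Λ : ℕ → E → Ω → ℝ} {X : ℕ → Ω → Finset E}

/-- A function that is jointly measurable on `R × Ω` extends by zero to `E × Ω`. -/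
theorem measurable_indicator_prod (hR : MeasurableSet R) {g : E → Ω → ℝ}
    (hg : Measurable fun z : R × Ω => g z.1 z.2) :
    Measurable fun z : E × Ω => R.indicator (fun u => g u z.2) z.1 := by
  have he : MeasurableEmbedding (Prod.map (Subtype.val : R → E) (id : Ω → Ω)) :=
    (MeasurableEmbedding.subtype_coe hR).prodMap .id
  convert he.measurable_extend hg (measurable_const (a := (0 : ℝ))) using 1
  funext z
  by_cases hz : z.1 ∈ R
  · have := he.injective.extend_apply (fun z : R × Ω => g z.1 z.2) (fun _ => 0) (⟨z.1, hz⟩, z.2)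
    simp only [Prod.map, id] at this
    rw [Set.indicator_of_mem hz, this]
  · rw [Set.indicator_of_notMem hz, Function.extend_apply']
    rintro ⟨y, rfl⟩
    exact hz y.1.2

theorem setLIntegral_ofReal_indicator (hB : MeasurableSet B) (hBR : B ⊆ R) (g : E → ℝ) :
    ∫⁻ u in B, ENNReal.ofReal (R.indicator g u) = ∫⁻ u in B, ENNReal.ofReal (g u) :=
  setLIntegral_congr_fun hB fun u hu => by simp only [Set.indicator_of_mem (hBR hu)]

theorem setIntegral_indicator_of_subset (hB : MeasurableSet B) (hBR : B ⊆ R) (g : E → ℝ) :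
    ∫ u in B, R.indicator g u = ∫ u in B, g u :=
  setIntegral_congr_fun hB fun u hu => by simp only [Set.indicator_of_mem (hBR hu)]

theorem measurable_setLIntegral_intensity [SFinite (volume : Measure E)] (hR : MeasurableSet R)
    (hB : MeasurableSet B) (hBR : B ⊆ R) {g : E → Ω → ℝ}
    (hg : Measurable fun z : R × Ω => g z.1 z.2) :
    Measurable fun ω => ∫⁻ u in B, ENNReal.ofReal (g u ω) := by
  rw [show (fun ω => ∫⁻ u in B, ENNReal.ofReal (g u ω)) =
      fun ω => ∫⁻ u in B, ENNReal.ofReal (R.indicator (fun u => g u ω) u) from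
    funext fun ω => (setLIntegral_ofReal_indicator hB hBR _).symm]
  exact (measurable_indicator_prod hR hg).ennreal_ofReal.lintegral_prod_left'

theorem measurable_setIntegral_intensity [SFinite (volume : Measure E)] (hR : MeasurableSet R)
    (hB : MeasurableSet B) (hBR : B ⊆ R) {g : E → Ω → ℝ}
    (hg : Measurable fun z : R × Ω => g z.1 z.2) :
    Measurable fun ω => ∫ u in B, g u ω := by
  rw [show (fun ω => ∫ u in B, g u ω) =
      fun ω => ∫ u in B, R.indicator (fun u => g u ω) u from
    funext fun ω => (setIntegral_indicator_of_subset hB hBR _).symm]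
  exact (measurable_indicator_prod hR hg).stronglyMeasurable.integral_prod_left'.measurable

/-- Poisson rates are Bochner integrals, which default to 0 when the integral diverges, whereas
moments are computed with `lintegral`. Finiteness of the latter is what makes the two agree. -/
theorem coe_toNNReal_setIntegral (hR : MeasurableSet R) (hB : MeasurableSet B) (hBR : B ⊆ R)
    {g : E → Ω → ℝ} (hg : Measurable fun z : R × Ω => g z.1 z.2) (h0 : ∀ u ω, 0 ≤ g u ω) {ω : Ω}
    (hω : ∫⁻ u in B, ENNReal.ofReal (g u ω) < ⊤) :
    (((∫ u in B, g u ω).toNNReal : ℝ≥0) : ℝ≥0∞) = ∫⁻ u in B, ENNReal.ofReal (g u ω) := by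
  rw [← setLIntegral_ofReal_indicator hB hBR] at hω ⊢
  rw [← setIntegral_indicator_of_subset hB hBR, integral_eq_lintegral_of_nonneg_ae
    (.of_forall fun u => Set.indicator_nonneg (fun u _ => h0 u ω) u)
    ((measurable_indicator_prod hR hg).comp measurable_prodMk_right).aestronglyMeasurable]
  exact ENNReal.ofReal_toReal hω.ne

theorem latentSigma_le (hΛ : ∀ t, 1 ≤ t → Measurable fun z : R × Ω => Λ t z.1 z.2) (n : ℕ) :
    latentSigma R Λ n ≤ ‹MeasurableSpace Ω› := by
  refine iSup₂_le fun t ht => iSup₂_le fun u hu => ?_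
  exact ((hΛ t (Finset.mem_Icc.1 ht).1).comp
    (measurable_prodMk_left (x := (⟨u, hu⟩ : R)))).comap_le

/-- The joint distribution of the counts in `B` at finitely many times. -/
theorem IsCoxSeries.measure_count_eq [IsProbabilityMeasure P] (hX : IsCoxSeries P R Λ X)
    (hΛ : ∀ t, 1 ≤ t → Measurable fun z : R × Ω => Λ t z.1 z.2)
    (hB : MeasurableSet B) (hBR : B ⊆ R) (T : Finset ℕ) (hT : ∀ t ∈ T, 1 ≤ t) (a : ℕ → ℕ) :
    P {ω | ∀ t ∈ T, count (X t ω) B = a t} =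
      ∫⁻ ω, ∏ t ∈ T, poissonMeasure (∫ u in B, Λ t u ω).toNNReal {a t} ∂P := by
  classical
  obtain ⟨n, hn⟩ : ∃ n, ∀ t ∈ T, t ≤ n := ⟨T.sup id, fun t ht => Finset.le_sup (f := id) ht⟩
  have hTn : T ⊆ Finset.Icc 1 n := fun t ht => Finset.mem_Icc.2 ⟨hT t ht, hn t ht⟩
  -- The conditional law concerns all times up to n. At times outside T the empty set is used: its
  -- count is 0, and the Poisson law of rate 0 gives 0 mass one, so those factors disappear.
  let B' : ℕ → Fin 1 → Set E := fun t _ => if t ∈ T then B else ∅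
  let m' : ℕ → Fin 1 → ℕ := fun t _ => if t ∈ T then a t else 0
  have hc := hX.condLaw n 1 B' m'
    (fun t i => by dsimp only [B']; split_ifs; exacts [hB, .empty])
    (fun t i => by dsimp only [B']; split_ifs; exacts [hBR, Set.empty_subset _])
    (fun t i i' h => (h (Subsingleton.elim _ _)).elim)
  have hset : {ω | ∀ t ∈ Finset.Icc 1 n, ∀ i, count (X t ω) (B' t i) = m' t i} =
      {ω | ∀ t ∈ T, count (X t ω) B = a t} := by
    ext ω
    simp only [Set.mem_ofPred_eq, B', m']
    constructor
    · intro h t ht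
      simpa [ht] using h t (hTn ht) 0
    · intro h t _ i
      by_cases htT : t ∈ T
      · simpa [htT] using h t htT
      · simp [htT, count_empty]
  have hprod : ∀ ω, ∏ t ∈ Finset.Icc 1 n, poissonCountProb (fun u => Λ t u ω) (B' t) (m' t) =
      ∏ t ∈ T, (poissonMeasure (∫ u in B, Λ t u ω).toNNReal).real {a t} := by
    intro ω
    rw [← Finset.prod_subset hTn]
    · refine Finset.prod_congr rfl fun t ht => ?_
      simp [poissonCountProb, B', m', ht]
    · intro t _ ht
      simp [poissonCountProb, B', m', ht, poissonMeasure_real_singleton]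
  rw [hset] at hc
  simp_rw [hprod] at hc
  have hms : MeasurableSet {ω | ∀ t ∈ T, count (X t ω) B = a t} := by
    have : {ω | ∀ t ∈ T, count (X t ω) B = a t} =
        ⋂ t ∈ T, (fun ω => count (X t ω) B) ⁻¹' {a t} := by ext ω; simp
    rw [this]
    exact Finset.measurableSet_biInter _ fun t ht =>
      hX.measurable_count t (hT t ht) B hB (measurableSet_singleton _)
  have hint := integral_condExp (μ := P) (latentSigma_le hΛ n)
    (f := ({ω | ∀ t ∈ T, count (X t ω) B = a t}).indicator fun _ => (1 : ℝ))
  rw [integral_congr_ae hc, integral_indicator_const _ hms, smul_eq_mul, mul_one] at hint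
  have hi : Integrable (fun ω => ∏ t ∈ T,
      (poissonMeasure (∫ u in B, Λ t u ω).toNNReal).real {a t}) P := integrable_condExp.congr hc
  rw [← ofReal_measureReal, ← hint, ofReal_integral_eq_lintegral_ofReal hi
    (.of_forall fun ω => Finset.prod_nonneg fun t _ => measureReal_nonneg)]
  refine lintegral_congr fun ω => ?_
  rw [ENNReal.ofReal_prod_of_nonneg fun t _ => measureReal_nonneg]
  exact Finset.prod_congr rfl fun t _ => ofReal_measureReal

theorem lintegral_comp_eq_tsum {ι : Type*} [Countable ι] [MeasurableSpace ι]
    [MeasurableSingletonClass ι] {f : Ω → ι} (hf : Measurable f) (g : ι → ℝ≥0∞) :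
    ∫⁻ ω, g (f ω) ∂P = ∑' i, g i * P {ω | f ω = i} := by
  rw [← lintegral_map (measurable_of_countable g) hf, lintegral_countable']
  refine tsum_congr fun i => ?_
  rw [Measure.map_apply hf (measurableSet_singleton i)]
  rfl

variable [SFinite (volume : Measure E)]

theorem measurable_poissonMeasure_intensity (hR : MeasurableSet R)
    (hB : MeasurableSet B) (hBR : B ⊆ R) {g : E → Ω → ℝ}
    (hg : Measurable fun z : R × Ω => g z.1 z.2) (a : ℕ) :
    Measurable fun ω => poissonMeasure (∫ u in B, g u ω).toNNReal {a} :=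
  (measurable_poissonMeasure_singleton a).comp
    (measurable_setIntegral_intensity hR hB hBR hg).real_toNNReal

/-- Moments of a single count of a Cox series. -/
theorem IsCoxSeries.lintegral_count [IsProbabilityMeasure P] (hX : IsCoxSeries P R Λ X)
    (hR : MeasurableSet R) (hΛ : ∀ t, 1 ≤ t → Measurable fun z : R × Ω => Λ t z.1 z.2)
    (hB : MeasurableSet B) (hBR : B ⊆ R) {t : ℕ} (ht : 1 ≤ t) (g : ℕ → ℝ≥0∞) :
    ∫⁻ ω, g (count (X t ω) B) ∂P =
      ∫⁻ ω, ∑' a, g a * poissonMeasure (∫ u in B, Λ t u ω).toNNReal {a} ∂P := by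
  rw [lintegral_comp_eq_tsum (hX.measurable_count t ht B hB) g,
    lintegral_tsum fun a =>
      ((measurable_poissonMeasure_intensity hR hB hBR (hΛ t ht) a).const_mul _).aemeasurable]
  refine tsum_congr fun a => ?_
  rw [lintegral_const_mul _ (measurable_poissonMeasure_intensity hR hB hBR (hΛ t ht) a)]
  have h := hX.measure_count_eq hΛ hB hBR {t} (by simpa using ht) (fun _ => a)
  simp only [Finset.mem_singleton, forall_eq, Finset.prod_singleton] at h
  rw [h]

/-- The mean of a count of a Cox series. -/
theorem IsCoxSeries.lintegral_count_id [IsProbabilityMeasure P] (hX : IsCoxSeries P R Λ X)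
    (hR : MeasurableSet R) (hΛ : ∀ t, 1 ≤ t → Measurable fun z : R × Ω => Λ t z.1 z.2)
    (h0 : ∀ t u ω, 0 ≤ Λ t u ω) (hB : MeasurableSet B) (hBR : B ⊆ R) {t : ℕ} (ht : 1 ≤ t)
    (hfin : ∀ᵐ ω ∂P, ∫⁻ u in B, ENNReal.ofReal (Λ t u ω) < ⊤) :
    ∫⁻ ω, (count (X t ω) B : ℝ≥0∞) ∂P =
      ∫⁻ ω, (∫⁻ u in B, ENNReal.ofReal (Λ t u ω)) ∂P := by
  rw [hX.lintegral_count hR hΛ hB hBR ht fun a => a]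
  refine lintegral_congr_ae (hfin.mono fun ω hω => ?_)
  simp only [tsum_mul_poissonMeasure_singleton]
  exact coe_toNNReal_setIntegral hR hB hBR (hΛ t ht) (h0 t) hω

/-- The second moment of a count of a Cox series. -/
theorem IsCoxSeries.lintegral_count_sq [IsProbabilityMeasure P] (hX : IsCoxSeries P R Λ X)
    (hR : MeasurableSet R) (hΛ : ∀ t, 1 ≤ t → Measurable fun z : R × Ω => Λ t z.1 z.2)
    (h0 : ∀ t u ω, 0 ≤ Λ t u ω) (hB : MeasurableSet B) (hBR : B ⊆ R) {t : ℕ} (ht : 1 ≤ t)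
    (hfin : ∀ᵐ ω ∂P, ∫⁻ u in B, ENNReal.ofReal (Λ t u ω) < ⊤) :
    ∫⁻ ω, (count (X t ω) B : ℝ≥0∞) ^ 2 ∂P =
      (∫⁻ ω, (∫⁻ u in B, ENNReal.ofReal (Λ t u ω)) ∂P) +
        ∫⁻ ω, (∫⁻ u in B, ENNReal.ofReal (Λ t u ω)) * (∫⁻ u in B, ENNReal.ofReal (Λ t u ω)) ∂P := by
  rw [hX.lintegral_count hR hΛ hB hBR ht fun a => (a : ℝ≥0∞) ^ 2,
    ← lintegral_add_left (measurable_setLIntegral_intensity hR hB hBR (hΛ t ht))]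
  refine lintegral_congr_ae (hfin.mono fun ω hω => ?_)
  simp only [tsum_sq_mul_poissonMeasure_singleton]
  rw [coe_toNNReal_setIntegral hR hB hBR (hΛ t ht) (h0 t) hω, sq]

/-- The mixed moment of the counts of a Cox series at two different times. -/
theorem IsCoxSeries.lintegral_count_mul [IsProbabilityMeasure P] (hX : IsCoxSeries P R Λ X)
    (hR : MeasurableSet R) (hΛ : ∀ t, 1 ≤ t → Measurable fun z : R × Ω => Λ t z.1 z.2)
    (h0 : ∀ t u ω, 0 ≤ Λ t u ω) (hB : MeasurableSet B) (hBR : B ⊆ R) {t s : ℕ} (ht : 1 ≤ t)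
    (hs : 1 ≤ s) (hts : t ≠ s)
    (hfin : ∀ t, 1 ≤ t → ∀ᵐ ω ∂P, ∫⁻ u in B, ENNReal.ofReal (Λ t u ω) < ⊤) :
    ∫⁻ ω, (count (X t ω) B : ℝ≥0∞) * (count (X s ω) B : ℝ≥0∞) ∂P =
      ∫⁻ ω, (∫⁻ u in B, ENNReal.ofReal (Λ t u ω)) * (∫⁻ u in B, ENNReal.ofReal (Λ s u ω)) ∂P := by
  have hmt := measurable_poissonMeasure_intensity hR hB hBR (hΛ t ht)
  have hms := measurable_poissonMeasure_intensity hR hB hBR (hΛ s hs)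
  have h1 := lintegral_comp_eq_tsum (P := P) ((hX.measurable_count t ht B hB).prodMk
    (hX.measurable_count s hs B hB)) fun i => (i.1 : ℝ≥0∞) * (i.2 : ℝ≥0∞)
  simp only at h1
  have h2 : ∀ i : ℕ × ℕ, P {ω | (count (X t ω) B, count (X s ω) B) = i} =
      ∫⁻ ω, poissonMeasure (∫ u in B, Λ t u ω).toNNReal {i.1} *
        poissonMeasure (∫ u in B, Λ s u ω).toNNReal {i.2} ∂P := by
    intro i
    have h := hX.measure_count_eq hΛ hB hBR {t, s} (by simp [ht, hs])
      (fun k => if k = t then i.1 else i.2)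
    simp only [Finset.mem_insert, Finset.mem_singleton, forall_eq_or_imp, forall_eq,
      Finset.prod_pair hts, if_true, if_neg hts.symm] at h
    rw [← h]
    congr 1
    ext ω
    simp [Prod.ext_iff]
  have hm : ∀ i : ℕ × ℕ, Measurable fun ω =>
      poissonMeasure (∫ u in B, Λ t u ω).toNNReal {i.1} *
        poissonMeasure (∫ u in B, Λ s u ω).toNNReal {i.2} := fun i => (hmt i.1).mul (hms i.2)
  rw [h1, tsum_congr fun i : ℕ × ℕ => show (i.1 : ℝ≥0∞) * (i.2 : ℝ≥0∞) *
      P {ω | (count (X t ω) B, count (X s ω) B) = i} = ∫⁻ ω, (i.1 : ℝ≥0∞) * (i.2 : ℝ≥0∞) *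
        (poissonMeasure (∫ u in B, Λ t u ω).toNNReal {i.1} *
        poissonMeasure (∫ u in B, Λ s u ω).toNNReal {i.2}) ∂P by
      rw [h2 i, lintegral_const_mul _ (hm i)],
    ← lintegral_tsum fun i => ((hm i).const_mul _).aemeasurable]
  refine lintegral_congr_ae ?_
  filter_upwards [hfin t ht, hfin s hs] with ω hω hω'
  rw [← coe_toNNReal_setIntegral hR hB hBR (hΛ t ht) (h0 t) hω,
    ← coe_toNNReal_setIntegral hR hB hBR (hΛ s hs) (h0 s) hω',
    ← tsum_mul_poissonMeasure_singleton, ← tsum_mul_poissonMeasure_singleton,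
    ENNReal.tsum_prod', ← ENNReal.tsum_mul_right]
  refine tsum_congr fun a => ?_
  rw [← ENNReal.tsum_mul_left]
  refine tsum_congr fun b => ?_
  ring

end Cox

/-! ### Exponential moments of Gaussian variables -/

section Gaussian

variable {Ω : Type*} [MeasurableSpace Ω] {P : Measure Ω}

/-- The moment generating function at 1; this is the source of the shift by half the variance. -/
theorem lintegral_exp_add_gaussian {Z : Ω → ℝ} (hZ : HasGaussianLaw Z P)
    (h0 : ∫ ω, Z ω ∂P = 0) (c : ℝ) :
    ∫⁻ ω, ENNReal.ofReal (Real.exp (c + Z ω)) ∂P =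
      ENNReal.ofReal (Real.exp (c + Var[Z; P] / 2)) := by
  have hmap := hZ.map_eq_gaussianReal
  have hi : Integrable (fun ω => Real.exp (1 * Z ω)) P := by
    have := integrable_exp_mul_gaussianReal (μ := P[Z]) (v := Var[Z; P].toNNReal) 1
    rw [← hmap] at this
    exact this.comp_aemeasurable hZ.aemeasurable
  have hm := mgf_gaussianReal hmap 1
  simp only [mgf, h0, Real.coe_toNNReal _ (variance_nonneg Z P)] at hm
  simp only [one_mul, mul_one, one_pow, zero_add] at hm hi
  simp_rw [Real.exp_add]
  rw [← ofReal_integral_eq_lintegral_ofReal (hi.const_mul _) (.of_forall fun ω => by positivity),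
    integral_const_mul, hm]

/-- Z + W is Gaussian with variance Var Z + Var W + 2 cov(Z, W), so dependence enters only through
the factor exp(cov). -/
theorem lintegral_exp_mul_exp_gaussian [IsProbabilityMeasure P] {Z W : Ω → ℝ}
    (hZW : HasGaussianLaw (fun ω => (Z ω, W ω)) P)
    (hZ : ∫ ω, Z ω ∂P = 0) (hW : ∫ ω, W ω ∂P = 0) (c d : ℝ) :
    ∫⁻ ω, ENNReal.ofReal (Real.exp (c + Z ω)) * ENNReal.ofReal (Real.exp (d + W ω)) ∂P =
      ENNReal.ofReal (Real.exp cov[Z, W; P]) * (ENNReal.ofReal (Real.exp (c + Var[Z; P] / 2)) *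
        ENNReal.ofReal (Real.exp (d + Var[W; P] / 2))) := by
  have h0 : ∫ ω, (Z + W) ω ∂P = 0 := by
    simp only [Pi.add_apply]
    rw [integral_add hZW.fst.integrable hZW.snd.integrable, hZ, hW, add_zero]
  have h := lintegral_exp_add_gaussian hZW.add h0 (c + d)
  rw [variance_add hZW.fst.memLp_two hZW.snd.memLp_two] at h
  simp_rw [← ENNReal.ofReal_mul (Real.exp_pos _).le, ← Real.exp_add]
  refine Eq.trans (lintegral_congr fun ω => ?_) (h.trans ?_)
  · congr 2
    simp only [Pi.add_apply]
    ring
  · congr 2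
    ring

/-- Expand Var(Z - W) ≥ 0. -/
theorem covariance_le_of_variance_le [IsProbabilityMeasure P] {Z W : Ω → ℝ} (hZ : MemLp Z 2 P)
    (hW : MemLp W 2 P) {V : ℝ} (hVZ : Var[Z; P] ≤ V) (hVW : Var[W; P] ≤ V) :
    cov[Z, W; P] ≤ V := by
  have h := variance_nonneg (Z - W) P
  rw [variance_sub hZ hW] at h
  linarith

end Gaussian

/-! ### Products of integrals as double integrals -/

section Tonelli

variable {E Ω : Type*} [MeasurableSpace E] [MeasurableSpace Ω] {μ : Measure E} {P : Measure Ω}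
  [SFinite μ] [SFinite P] {F G : E → Ω → ℝ≥0∞}

theorem lintegral_mul_lintegral_eq (hF : Measurable fun z : E × Ω => F z.1 z.2)
    (hG : Measurable fun z : E × Ω => G z.1 z.2) :
    ∫⁻ ω, (∫⁻ u, F u ω ∂μ) * (∫⁻ u, G u ω ∂μ) ∂P =
      ∫⁻ u, ∫⁻ u', (∫⁻ ω, F u ω * G u' ω ∂P) ∂μ ∂μ := by
  have hF' : ∀ ω, Measurable fun u => F u ω := fun ω => hF.comp measurable_prodMk_right
  have hG' : ∀ ω, Measurable fun u => G u ω := fun ω => hG.comp measurable_prodMk_right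
  have h1 : ∀ ω, (∫⁻ u, F u ω ∂μ) * (∫⁻ u, G u ω ∂μ) =
      ∫⁻ u, ∫⁻ u', F u ω * G u' ω ∂μ ∂μ := by
    intro ω
    rw [← lintegral_mul_const _ (hF' ω)]
    exact lintegral_congr fun u => (lintegral_const_mul _ (hG' ω)).symm
  simp_rw [h1]
  rw [lintegral_lintegral_swap]
  · refine lintegral_congr fun u => ?_
    rw [lintegral_lintegral_swap]
    exact (((hF.comp (measurable_prodMk_left (x := u))).comp measurable_fst).mul
      (hG.comp measurable_swap)).aemeasurable
  · refine Measurable.aemeasurable ?_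
    refine Measurable.lintegral_prod_right' (f := fun z : (Ω × E) × E => F z.1.2 z.1.1 * G z.2 z.1.1)
      ?_
    exact (hF.comp (measurable_swap.comp measurable_fst)).mul
      (hG.comp (measurable_snd.prodMk (measurable_fst.comp measurable_fst)))

theorem lintegral_lintegral_const_mul_mul {f g : E → ℝ≥0∞} (hf : AEMeasurable f μ)
    (hg : AEMeasurable g μ) (c : ℝ≥0∞) :
    ∫⁻ u, ∫⁻ u', c * (f u * g u') ∂μ ∂μ = c * ((∫⁻ u, f u ∂μ) * ∫⁻ u, g u ∂μ) := by
  have : ∀ u, ∫⁻ u', c * (f u * g u') ∂μ = c * (f u * ∫⁻ u', g u' ∂μ) := fun u => by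
    rw [lintegral_const_mul'' _ (hg.const_mul _), lintegral_const_mul'' _ hg]
  simp_rw [this]
  rw [lintegral_const_mul'' _ (hf.mul_const _), lintegral_mul_const'' _ hf]

end Tonelli

/-! ### First and mixed moments of integrated log-Gaussian intensities -/

section LogGaussian

variable {E Ω : Type*} [MeasureSpace E] [SFinite (volume : Measure E)] [MeasurableSpace Ω]
  {P : Measure Ω} [IsProbabilityMeasure P] {R B : Set E} {Y : ℕ → E → Ω → ℝ} {γ : ℕ → E → E → ℝ}
  {m lam : ℕ → E → ℝ}

theorem IsStationaryGaussianSeries.hasGaussianLaw_prodMk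
    (hY : IsStationaryGaussianSeries P R Y γ) {t s : ℕ} (ht : 1 ≤ t) (hs : 1 ≤ s) {u u' : E}
    (hu : u ∈ R) (hu' : u' ∈ R) : HasGaussianLaw (fun ω => (Y t u ω, Y s u' ω)) P :=
  hY.gaussian.hasGaussianLaw_prodMk (s := (⟨t, ht⟩, ⟨u, hu⟩)) (t := (⟨s, hs⟩, ⟨u', hu'⟩))

theorem IsStationaryGaussianSeries.memLp_two (hY : IsStationaryGaussianSeries P R Y γ) {t : ℕ}
    (ht : 1 ≤ t) {u : E} (hu : u ∈ R) : MemLp (Y t u) 2 P :=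
  (hY.hasGaussianLaw_prodMk ht ht hu hu).fst.memLp_two

theorem measurable_logIntensity (hY : IsStationaryGaussianSeries P R Y γ)
    (hm : ∀ t, Measurable fun u : R => m t u) (t : ℕ) (ht : 1 ≤ t) :
    Measurable fun z : R × Ω => Real.exp (m t z.1 + Y t z.1 z.2) :=
  (((hm t).comp measurable_fst).add (hY.measurable t ht)).exp

theorem measurable_ofReal_indicator_logIntensity (hY : IsStationaryGaussianSeries P R Y γ)
    (hR : MeasurableSet R) (hm : ∀ t, Measurable fun u : R => m t u) (t : ℕ) (ht : 1 ≤ t) :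
    Measurable fun z : E × Ω =>
      ENNReal.ofReal (R.indicator (fun u => Real.exp (m t u + Y t u z.2)) z.1) :=
  (measurable_indicator_prod hR (g := fun u ω => Real.exp (m t u + Y t u ω))
    (measurable_logIntensity hY hm t ht)).ennreal_ofReal

theorem lintegral_setLIntegral_logIntensity (hY : IsStationaryGaussianSeries P R Y γ)
    (hR : MeasurableSet R) (hm : ∀ t, Measurable fun u : R => m t u)
    (hlam : ∀ t, 1 ≤ t → ∀ u ∈ R, lam t u = Real.exp (m t u + Var[Y t u; P] / 2))
    (hB : MeasurableSet B) (hBR : B ⊆ R) {t : ℕ} (ht : 1 ≤ t) :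
    ∫⁻ ω, (∫⁻ u in B, ENNReal.ofReal (Real.exp (m t u + Y t u ω))) ∂P =
      ∫⁻ u in B, ENNReal.ofReal (lam t u) := by
  -- Tonelli needs joint measurability on E × Ω, while Y is measurable only on R × Ω; extension by
  -- zero outside R bridges the gap.
  simp_rw [fun ω => (setLIntegral_ofReal_indicator hB hBR
    fun u => Real.exp (m t u + Y t u ω)).symm]
  rw [lintegral_lintegral_swap]
  swap
  · exact ((measurable_ofReal_indicator_logIntensity hY hR hm t ht).comp
      measurable_swap).aemeasurable
  refine setLIntegral_congr_fun hB fun u hu => ?_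
  simp only [Set.indicator_of_mem (hBR hu)]
  rw [lintegral_exp_add_gaussian (hY.hasGaussianLaw_prodMk ht ht (hBR hu) (hBR hu)).fst
    (hY.mean_zero t ht u (hBR hu)), hlam t ht u (hBR hu)]

theorem lintegral_mul_logIntensity_eq (hY : IsStationaryGaussianSeries P R Y γ)
    (hR : MeasurableSet R) (hm : ∀ t, Measurable fun u : R => m t u)
    (hlam : ∀ t, 1 ≤ t → ∀ u ∈ R, lam t u = Real.exp (m t u + Var[Y t u; P] / 2))
    (hB : MeasurableSet B) (hBR : B ⊆ R) {t s : ℕ} (ht : 1 ≤ t) (hs : 1 ≤ s) :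
    ∫⁻ ω, (∫⁻ u in B, ENNReal.ofReal (Real.exp (m t u + Y t u ω))) *
        (∫⁻ u in B, ENNReal.ofReal (Real.exp (m s u + Y s u ω))) ∂P =
      ∫⁻ u in B, ∫⁻ u' in B, ENNReal.ofReal (Real.exp cov[Y t u, Y s u'; P]) *
        (ENNReal.ofReal (lam t u) * ENNReal.ofReal (lam s u')) := by
  simp_rw [fun (t : ℕ) ω => (setLIntegral_ofReal_indicator hB hBR
    fun u => Real.exp (m t u + Y t u ω)).symm]
  rw [lintegral_mul_lintegral_eq (measurable_ofReal_indicator_logIntensity hY hR hm t ht)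
    (measurable_ofReal_indicator_logIntensity hY hR hm s hs)]
  refine setLIntegral_congr_fun hB fun u hu => setLIntegral_congr_fun hB fun u' hu' => ?_
  simp only [Set.indicator_of_mem (hBR hu), Set.indicator_of_mem (hBR hu')]
  rw [lintegral_exp_mul_exp_gaussian (hY.hasGaussianLaw_prodMk ht hs (hBR hu) (hBR hu'))
    (hY.mean_zero t ht u (hBR hu)) (hY.mean_zero s hs u' (hBR hu')), hlam t ht u (hBR hu),
    hlam s hs u' (hBR hu')]

theorem aemeasurable_restrict_of_subset {α : Type*} [MeasurableSpace α] (hR : MeasurableSet R)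
    (hBR : B ⊆ R) {g : E → α} (hg : Measurable fun u : R => g u) :
    AEMeasurable g (volume.restrict B) :=
  ((MeasurableEmbedding.subtype_coe hR).aemeasurable_map_iff.2 hg.aemeasurable |>.mono_measure
    ((map_comap_subtype_coe hR volume).ge) |>.mono_measure (Measure.restrict_mono hBR le_rfl))

/-- A bound on the covariance kernel pulls out of the double integral. It serves twice: with the
variance bound, for finite second moments, and with a small constant, for decorrelation at large
lags. -/
theorem lintegral_mul_logIntensity_le (hY : IsStationaryGaussianSeries P R Y γ)
    (hR : MeasurableSet R) (hm : ∀ t, Measurable fun u : R => m t u)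
    (hlam : ∀ t, 1 ≤ t → ∀ u ∈ R, lam t u = Real.exp (m t u + Var[Y t u; P] / 2))
    (hlm : ∀ t, Measurable fun u : R => lam t u)
    (hB : MeasurableSet B) (hBR : B ⊆ R) {t s : ℕ} (ht : 1 ≤ t) (hs : 1 ≤ s) {c : ℝ}
    (hc : ∀ u ∈ R, ∀ u' ∈ R, cov[Y t u, Y s u'; P] ≤ c) :
    ∫⁻ ω, (∫⁻ u in B, ENNReal.ofReal (Real.exp (m t u + Y t u ω))) *
        (∫⁻ u in B, ENNReal.ofReal (Real.exp (m s u + Y s u ω))) ∂P ≤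
      ENNReal.ofReal (Real.exp c) * ((∫⁻ u in B, ENNReal.ofReal (lam t u)) *
        ∫⁻ u in B, ENNReal.ofReal (lam s u)) := by
  rw [lintegral_mul_logIntensity_eq hY hR hm hlam hB hBR ht hs,
    ← lintegral_lintegral_const_mul_mul (aemeasurable_restrict_of_subset hR hBR (hlm t)).ennreal_ofReal
    (aemeasurable_restrict_of_subset hR hBR (hlm s)).ennreal_ofReal]
  refine setLIntegral_mono' hB fun u hu => setLIntegral_mono' hB fun u' hu' => ?_
  gcongr
  exact hc u (hBR hu) u' (hBR hu')

theorem le_lintegral_mul_logIntensity (hY : IsStationaryGaussianSeries P R Y γ)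
    (hR : MeasurableSet R) (hm : ∀ t, Measurable fun u : R => m t u)
    (hlam : ∀ t, 1 ≤ t → ∀ u ∈ R, lam t u = Real.exp (m t u + Var[Y t u; P] / 2))
    (hlm : ∀ t, Measurable fun u : R => lam t u)
    (hB : MeasurableSet B) (hBR : B ⊆ R) {t s : ℕ} (ht : 1 ≤ t) (hs : 1 ≤ s) {c : ℝ}
    (hc : ∀ u ∈ R, ∀ u' ∈ R, c ≤ cov[Y t u, Y s u'; P]) :
    ENNReal.ofReal (Real.exp c) * ((∫⁻ u in B, ENNReal.ofReal (lam t u)) *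
        ∫⁻ u in B, ENNReal.ofReal (lam s u)) ≤
      ∫⁻ ω, (∫⁻ u in B, ENNReal.ofReal (Real.exp (m t u + Y t u ω))) *
        (∫⁻ u in B, ENNReal.ofReal (Real.exp (m s u + Y s u ω))) ∂P := by
  rw [lintegral_mul_logIntensity_eq hY hR hm hlam hB hBR ht hs,
    ← lintegral_lintegral_const_mul_mul (aemeasurable_restrict_of_subset hR hBR (hlm t)).ennreal_ofReal
    (aemeasurable_restrict_of_subset hR hBR (hlm s)).ennreal_ofReal]
  refine setLIntegral_mono' hB fun u hu => setLIntegral_mono' hB fun u' hu' => ?_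
  gcongr
  exact hc u (hBR hu) u' (hBR hu')

end LogGaussian

/-! ### A weak law under asymptotic decorrelation -/

section LawOfLargeNumbers

variable {Ω : Type*} [MeasurableSpace Ω] {P : Measure Ω} [IsProbabilityMeasure P]

/-- The second moment of a sum of variables whose mixed moments are at most `C`, and at most `ε`
at lag `K` or more. -/
theorem integral_sum_sq_le {Z : ℕ → Ω → ℝ} (hZ : ∀ t, 1 ≤ t → MemLp (Z t) 2 P) {C ε : ℝ}
    (hC0 : 0 ≤ C) (hε0 : 0 ≤ ε)
    (hC : ∀ t s, 1 ≤ t → 1 ≤ s → ∫ ω, Z t ω * Z s ω ∂P ≤ C) {K : ℕ}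
    (hK : ∀ t s, 1 ≤ t → t + K ≤ s → ∫ ω, Z t ω * Z s ω ∂P ≤ ε) (n : ℕ) :
    ∫ ω, (∑ t ∈ Finset.Icc 1 n, Z t ω) ^ 2 ∂P ≤ n ^ 2 * ε + n * (2 * K * C) := by
  have h1 : ∀ t ∈ Finset.Icc 1 n, 1 ≤ t := fun t ht => (Finset.mem_Icc.1 ht).1
  have hi : ∀ t ∈ Finset.Icc 1 n, ∀ s ∈ Finset.Icc 1 n, Integrable (fun ω => Z t ω * Z s ω) P :=
    fun t ht s hs => (hZ t (h1 t ht)).integrable_mul (hZ s (h1 s hs))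
  simp_rw [sq, Finset.sum_mul_sum]
  rw [integral_finsetSum _ fun t ht => integrable_finsetSum _ fun s hs => hi t ht s hs]
  have hrow : ∀ t ∈ Finset.Icc 1 n, ∫ ω, ∑ s ∈ Finset.Icc 1 n, Z t ω * Z s ω ∂P ≤
      n * ε + 2 * K * C := by
    intro t ht
    rw [integral_finsetSum _ fun s hs => hi t ht s hs]
    -- The window consists of the s with |s - t| < K; truncated subtraction is harmless at its lower
    -- end. It has at most 2K elements, and outside it one of the two orders of s and t has lag at
    -- least K.
    have hle : ∀ s ∈ Finset.Icc 1 n, ∫ ω, Z t ω * Z s ω ∂P ≤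
        ε + if s ∈ Finset.Ico (t + 1 - K) (t + K) then C else 0 := by
      intro s hs
      split_ifs with h
      · linarith [hC t s (h1 t ht) (h1 s hs)]
      · rw [add_zero]
        rw [Finset.mem_Ico, not_and_or] at h
        by_cases h' : t + K ≤ s
        · exact hK t s (h1 t ht) h'
        · simp_rw [mul_comm (Z t _)]
          exact hK s t (h1 s hs) (by omega)
    refine (Finset.sum_le_sum hle).trans ?_
    rw [Finset.sum_add_distrib, Finset.sum_const, Nat.card_Icc, ← Finset.sum_filter,
      Finset.sum_const, nsmul_eq_mul, nsmul_eq_mul]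
    have hcard : (Finset.filter (· ∈ Finset.Ico (t + 1 - K) (t + K)) (Finset.Icc 1 n)).card ≤
        2 * K := by
      refine (Finset.card_le_card (t := Finset.Ico (t + 1 - K) (t + K)) fun s hs =>
        (Finset.mem_filter.1 hs).2).trans ?_
      rw [Nat.card_Ico]
      omega
    have hcard' : ((Finset.filter (· ∈ Finset.Ico (t + 1 - K) (t + K)) (Finset.Icc 1 n)).card : ℝ) ≤
        2 * K := by exact_mod_cast hcard
    have := mul_le_mul_of_nonneg_right hcard' hC0
    simpa using this
  refine (Finset.sum_le_sum hrow).trans (le_of_eq ?_)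
  simp only [Finset.sum_const, Nat.card_Icc, nsmul_eq_mul, Nat.add_sub_cancel]
  ring

/-- Weak law of large numbers for variables that are asymptotically uncorrelated. -/
theorem tendstoInMeasure_average {Z : ℕ → Ω → ℝ} (hZ : ∀ t, 1 ≤ t → MemLp (Z t) 2 P) {C : ℝ}
    (hC : ∀ t s, 1 ≤ t → 1 ≤ s → ∫ ω, Z t ω * Z s ω ∂P ≤ C)
    (hcov : ∀ ε, 0 < ε → ∃ K : ℕ, ∀ t s, 1 ≤ t → t + K ≤ s → ∫ ω, Z t ω * Z s ω ∂P ≤ ε) :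
    TendstoInMeasure P (fun (n : ℕ) ω => (1 / (n : ℝ)) * ∑ t ∈ Finset.Icc 1 n, Z t ω) atTop
      fun _ => 0 := by
  have hC0 : 0 ≤ C := (integral_nonneg fun ω => mul_self_nonneg (Z 1 ω)).trans (hC 1 1 le_rfl le_rfl)
  rw [tendstoInMeasure_iff_measureReal_norm]
  intro δ hδ
  have hmem : ∀ n : ℕ, MemLp (fun ω => ∑ t ∈ Finset.Icc 1 n, Z t ω) 2 P := fun n =>
    memLp_finsetSum _ fun t ht => hZ t (Finset.mem_Icc.1 ht).1
  have hmarkov : ∀ n : ℕ, 1 ≤ n →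
      P.real {ω | δ ≤ ‖(1 / (n : ℝ)) * ∑ t ∈ Finset.Icc 1 n, Z t ω - 0‖} ≤
        (∫ ω, (∑ t ∈ Finset.Icc 1 n, Z t ω) ^ 2 ∂P) / (n * δ) ^ 2 := by
    intro n hn
    have hn0 : (0 : ℝ) < n := by exact_mod_cast hn
    have h := mul_meas_ge_le_integral_of_nonneg (μ := P)
      (f := fun ω => (∑ t ∈ Finset.Icc 1 n, Z t ω) ^ 2) (.of_forall fun ω => sq_nonneg _)
      (hmem n).integrable_sq ((n * δ) ^ 2)
    rw [le_div_iff₀ (by positivity), mul_comm]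
    refine le_trans (mul_le_mul_of_nonneg_left ?_ (by positivity)) h
    refine measureReal_mono fun ω hω => ?_
    simp only [Set.mem_ofPred_eq] at hω ⊢
    rw [sub_zero, norm_mul, Real.norm_eq_abs, Real.norm_eq_abs, abs_of_pos (by positivity)] at hω
    rw [← sq_abs (∑ t ∈ Finset.Icc 1 n, Z t ω)]
    have : n * δ ≤ |∑ t ∈ Finset.Icc 1 n, Z t ω| := by
      rw [one_div, ← div_eq_inv_mul, le_div_iff₀ hn0] at hω
      linarith
    gcongr
  rw [Metric.tendsto_atTop]
  intro e he
  -- After division by (nδ)², pairs at large lag contribute e/2; N is chosen so that the O(n) pairs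
  -- at small lag contribute less than e/2.
  obtain ⟨K, hK⟩ := hcov (e * δ ^ 2 / 2) (by positivity)
  obtain ⟨N, hN⟩ := exists_nat_gt (2 * K * C / (e * δ ^ 2 / 2))
  refine ⟨N + 1, fun n hn => ?_⟩
  have hn1 : 1 ≤ n := by omega
  have hn0 : (0 : ℝ) < n := by exact_mod_cast hn1
  rw [Real.dist_0_eq_abs, abs_of_nonneg measureReal_nonneg]
  refine (hmarkov n hn1).trans_lt ?_
  rw [div_lt_iff₀ (by positivity)]
  refine (integral_sum_sq_le hZ hC0 (by positivity) hC hK n).trans_lt ?_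
  have hNn : (N : ℝ) ≤ n := by exact_mod_cast (by omega : N ≤ n)
  have h2 : 2 * K * C < n * (e * δ ^ 2 / 2) := by
    rw [div_lt_iff₀ (by positivity)] at hN
    exact hN.trans_le (by gcongr)
  nlinarith [mul_lt_mul_of_pos_left h2 hn0]

end LawOfLargeNumbers

/-! ### Calculus of convergence to zero in measure -/

section InMeasure

variable {Ω : Type*} [MeasurableSpace Ω] {P : Measure Ω}

/-- Only monotonicity of the outer measure is used, so neither f n nor the sets S n need be
measurable. -/
theorem tendstoInMeasure_zero_of_forall_subset {f : ℕ → Ω → ℝ}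
    (h : ∀ δ, 0 < δ → ∃ S : ℕ → Set Ω, Tendsto (fun n => P (S n)) atTop (𝓝 0) ∧
      ∀ᶠ n in atTop, {ω | δ ≤ |f n ω|} ⊆ S n) :
    TendstoInMeasure P f atTop fun _ => 0 := by
  rw [tendstoInMeasure_iff_norm]
  intro δ hδ
  obtain ⟨S, hS, hfS⟩ := h δ hδ
  refine tendsto_of_tendsto_of_tendsto_of_le_of_le' tendsto_const_nhds hS
    (.of_forall fun _ => zero_le) (hfS.mono fun n hn => measure_mono ?_)
  simpa using hn

theorem tendsto_measure_of_tendstoInMeasure_zero {f : ℕ → Ω → ℝ}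
    (hf : TendstoInMeasure P f atTop fun _ => 0) {δ : ℝ} (hδ : 0 < δ) :
    Tendsto (fun n => P {ω | δ ≤ |f n ω|}) atTop (𝓝 0) := by
  simpa using tendstoInMeasure_iff_norm.1 hf δ hδ

theorem tendsto_measure_union_zero {S T : ℕ → Set Ω} (hS : Tendsto (fun n => P (S n)) atTop (𝓝 0))
    (hT : Tendsto (fun n => P (T n)) atTop (𝓝 0)) :
    Tendsto (fun n => P (S n ∪ T n)) atTop (𝓝 0) :=
  tendsto_of_tendsto_of_tendsto_of_le_of_le tendsto_const_nhds (by simpa using hS.add hT)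
    (fun _ => zero_le) fun n => measure_union_le _ _

theorem tendstoInMeasure_zero_add {f g : ℕ → Ω → ℝ}
    (hf : TendstoInMeasure P f atTop fun _ => 0) (hg : TendstoInMeasure P g atTop fun _ => 0) :
    TendstoInMeasure P (fun n ω => f n ω + g n ω) atTop fun _ => 0 := by
  refine tendstoInMeasure_zero_of_forall_subset fun δ hδ => ⟨_, tendsto_measure_union_zero
    (tendsto_measure_of_tendstoInMeasure_zero hf (half_pos hδ))
    (tendsto_measure_of_tendstoInMeasure_zero hg (half_pos hδ)), .of_forall fun n ω hω => ?_⟩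
  simp only [Set.mem_ofPred_eq, Set.mem_union] at hω ⊢
  by_contra! h
  linarith [abs_add_le (f n ω) (g n ω)]

theorem tendstoInMeasure_zero_const_mul {f : ℕ → Ω → ℝ}
    (hf : TendstoInMeasure P f atTop fun _ => 0) (c : ℝ) :
    TendstoInMeasure P (fun n ω => c * f n ω) atTop fun _ => 0 := by
  refine tendstoInMeasure_zero_of_forall_subset fun δ hδ => ⟨_,
    tendsto_measure_of_tendstoInMeasure_zero hf (δ := δ / (|c| + 1)) (by positivity),
    .of_forall fun n ω hω => ?_⟩
  simp only [Set.mem_ofPred_eq, abs_mul] at hω ⊢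
  rw [div_le_iff₀ (by positivity)]
  nlinarith [abs_nonneg (f n ω)]

theorem tendstoInMeasure_zero_sum {ι : Type*} (s : Finset ι) {f : ι → ℕ → Ω → ℝ}
    (hf : ∀ i ∈ s, TendstoInMeasure P (f i) atTop fun _ => 0) :
    TendstoInMeasure P (fun n ω => ∑ i ∈ s, f i n ω) atTop fun _ => 0 := by
  classical
  induction s using Finset.induction_on with
  | empty =>
    refine tendstoInMeasure_zero_of_forall_subset fun δ hδ => ⟨fun _ => ∅, by simp,
      .of_forall fun n ω hω => ?_⟩
    simp only [Finset.sum_empty, abs_zero, Set.mem_ofPred_eq] at hω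
    linarith
  | insert i s hi ih =>
    simp_rw [Finset.sum_insert hi]
    exact tendstoInMeasure_zero_add (hf i (Finset.mem_insert_self _ _))
      (ih fun j hj => hf j (Finset.mem_insert_of_mem hj))

end InMeasure

/-! ### Weak law for counts and for sums over the points -/

theorem count_eq_sum {E : Type*} (x : Finset E) (B : Set E) :
    (count x B : ℝ) = ∑ u ∈ x, B.indicator (fun _ => (1 : ℝ)) u := by
  classical
  have h : (x : Set E) ∩ B = ((x.filter (· ∈ B) : Finset E) : Set E) := by ext; simp
  rw [count, h, Set.ncard_coe_finset, Finset.card_filter]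
  push_cast
  exact Finset.sum_congr rfl fun u _ => by simp [Set.indicator_apply]

/-- Uniform approximation of a bounded function by a simple function. -/
theorem exists_simple_approx {E : Type*} [MeasurableSpace E] {R : Set E} (hR : MeasurableSet R)
    {φ : E → ℝ} (hφ : Measurable fun u : R => φ u) {C : ℝ} (hC : ∀ u ∈ R, |φ u| ≤ C) {e : ℝ}
    (he : 0 < e) :
    ∃ (I : Finset ℤ) (c : ℤ → ℝ) (B : ℤ → Set E), (∀ i, MeasurableSet (B i)) ∧ (∀ i, B i ⊆ R) ∧
      ∀ u ∈ R, |φ u - ∑ i ∈ I, c i * (B i).indicator (fun _ => (1 : ℝ)) u| ≤ e := by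
  classical
  -- Level sets of ⌊φ/e⌋; the value e * i on the i-th one is below φ by less than e. They are images
  -- from the subtype because φ is measurable only on R.
  let B : ℤ → Set E := fun i => (↑) '' {u : R | ⌊φ u / e⌋ = i}
  have hBmem : ∀ i u, u ∈ R → (u ∈ B i ↔ ⌊φ u / e⌋ = i) := by
    intro i u hu
    simp [B, hu]
  refine ⟨Finset.Icc ⌊-C / e⌋ ⌊C / e⌋, fun i => e * i, B, fun i => hR.subtype_image
    ((hφ.div_const e).floor (measurableSet_singleton i)), fun i => by simp [B], fun u hu => ?_⟩
  have hmem : ⌊φ u / e⌋ ∈ Finset.Icc ⌊-C / e⌋ ⌊C / e⌋ := by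
    have := abs_le.1 (hC u hu)
    exact Finset.mem_Icc.2 ⟨Int.floor_mono (by gcongr; exact this.1),
      Int.floor_mono (by gcongr; exact this.2)⟩
  simp only [Set.indicator_apply, hBmem _ u hu, mul_ite, mul_one, mul_zero]
  rw [Finset.sum_ite_eq, if_pos hmem]
  have h1 := Int.floor_le (φ u / e)
  have h2 := Int.lt_floor_add_one (φ u / e)
  rw [le_div_iff₀ he] at h1
  rw [div_lt_iff₀ he] at h2
  rw [abs_le]
  constructor <;> linarith

section Counts

variable {E Ω : Type*} [MeasureSpace E] [SFinite (volume : Measure E)] [MeasurableSpace Ω]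
  {P : Measure Ω} [IsProbabilityMeasure P] {R B : Set E} {Y : ℕ → E → Ω → ℝ} {γ : ℕ → E → E → ℝ}
  {m lam : ℕ → E → ℝ} {X : ℕ → Ω → Finset E}

/-- A log-Gaussian Cox series: the log-intensities are `m_t + Y_t`, the mean intensities `lam_t`
are bounded by `L`, the variances by `V`, and the autocovariances vanish uniformly. -/
structure IsLogGaussianCoxSeries (P : Measure Ω) (R : Set E) (m : ℕ → E → ℝ) (Y : ℕ → E → Ω → ℝ)
    (γ : ℕ → E → E → ℝ) (X : ℕ → Ω → Finset E) (lam : ℕ → E → ℝ) (L V : ℝ) : Prop where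
  measurableSet : MeasurableSet R
  volume_lt_top : volume R < ⊤
  cox : IsCoxSeries P R (fun t u ω => Real.exp (m t u + Y t u ω)) X
  gaussian : IsStationaryGaussianSeries P R Y γ
  measurable_mean : ∀ t, Measurable fun u : R => m t u
  measurable_lam : ∀ t, Measurable fun u : R => lam t u
  lam_nonneg : ∀ t u, 0 ≤ lam t u
  lam_le : ∀ t, 1 ≤ t → ∀ u ∈ R, lam t u ≤ L
  variance_le : ∀ t, 1 ≤ t → ∀ u ∈ R, Var[Y t u; P] ≤ V
  lam_eq : ∀ t, 1 ≤ t → ∀ u ∈ R, lam t u = Real.exp (m t u + Var[Y t u; P] / 2)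
  autocov_tendsto : TendstoUniformlyOn (fun k (z : E × E) => γ k z.1 z.2) 0 atTop (R ×ˢ R)

namespace IsLogGaussianCoxSeries

variable {L V : ℝ} (h : IsLogGaussianCoxSeries P R m Y γ X lam L V)

include h

theorem covariance_le {t s : ℕ} (ht : 1 ≤ t) (hs : 1 ≤ s) {u u' : E} (hu : u ∈ R) (hu' : u' ∈ R) :
    cov[Y t u, Y s u'; P] ≤ V :=
  covariance_le_of_variance_le (h.gaussian.memLp_two ht hu) (h.gaussian.memLp_two hs hu')
    (h.variance_le t ht u hu) (h.variance_le s hs u' hu')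

theorem setLIntegral_lam_lt_top (hB : MeasurableSet B) (hBR : B ⊆ R) {t : ℕ} (ht : 1 ≤ t) :
    ∫⁻ u in B, ENNReal.ofReal (lam t u) < ⊤ := by
  refine (setLIntegral_mono' hB (g := fun _ => ENNReal.ofReal L) fun u hu =>
    ENNReal.ofReal_le_ofReal (h.lam_le t ht u (hBR hu))).trans_lt ?_
  rw [setLIntegral_const]
  exact ENNReal.mul_lt_top ENNReal.ofReal_lt_top ((measure_mono hBR).trans_lt h.volume_lt_top)

theorem aestronglyMeasurable_lam (hBR : B ⊆ R) (t : ℕ) :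
    AEStronglyMeasurable (lam t) (volume.restrict B) :=
  (aemeasurable_restrict_of_subset h.measurableSet hBR (h.measurable_lam t)).aestronglyMeasurable

theorem integrableOn_lam (hB : MeasurableSet B) (hBR : B ⊆ R) {t : ℕ} (ht : 1 ≤ t) :
    IntegrableOn (lam t) B := by
  refine ⟨h.aestronglyMeasurable_lam hBR t, ?_⟩
  rw [hasFiniteIntegral_iff_ofReal (.of_forall fun u => h.lam_nonneg t u)]
  exact h.setLIntegral_lam_lt_top hB hBR ht

theorem toReal_setLIntegral_lam (hBR : B ⊆ R) (t : ℕ) :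
    (∫⁻ u in B, ENNReal.ofReal (lam t u)).toReal = ∫ u in B, lam t u :=
  (integral_eq_lintegral_of_nonneg_ae (.of_forall fun u => h.lam_nonneg t u)
    (h.aestronglyMeasurable_lam hBR t)).symm

theorem setIntegral_lam_nonneg (t : ℕ) : 0 ≤ ∫ u in B, lam t u :=
  integral_nonneg fun u => h.lam_nonneg t u

theorem setIntegral_lam_le (hBR : B ⊆ R) {t : ℕ} (ht : 1 ≤ t) :
    ∫ u in B, lam t u ≤ L * volume.real R := by
  have hRfin : volume R ≠ ⊤ := h.volume_lt_top.ne
  calc ∫ u in B, lam t u ≤ ∫ u in R, lam t u :=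
        setIntegral_mono_set (h.integrableOn_lam h.measurableSet le_rfl ht)
          (.of_forall fun u => h.lam_nonneg t u) hBR.eventuallyLE
    _ ≤ ∫ u in R, L := setIntegral_mono_on (h.integrableOn_lam h.measurableSet le_rfl ht)
          (integrableOn_const hRfin) h.measurableSet (h.lam_le t ht)
    _ = L * volume.real R := by rw [setIntegral_const, smul_eq_mul, mul_comm]

theorem measurable_intensity {t : ℕ} (ht : 1 ≤ t) :
    Measurable fun z : R × Ω => Real.exp (m t z.1 + Y t z.1 z.2) :=
  measurable_logIntensity h.gaussian h.measurable_mean t ht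

theorem lintegral_intensity (hB : MeasurableSet B) (hBR : B ⊆ R) {t : ℕ} (ht : 1 ≤ t) :
    ∫⁻ ω, (∫⁻ u in B, ENNReal.ofReal (Real.exp (m t u + Y t u ω))) ∂P =
      ∫⁻ u in B, ENNReal.ofReal (lam t u) :=
  lintegral_setLIntegral_logIntensity h.gaussian h.measurableSet h.measurable_mean h.lam_eq
    hB hBR ht

theorem ae_setLIntegral_intensity_lt_top (hB : MeasurableSet B) (hBR : B ⊆ R) {t : ℕ}
    (ht : 1 ≤ t) :
    ∀ᵐ ω ∂P, ∫⁻ u in B, ENNReal.ofReal (Real.exp (m t u + Y t u ω)) < ⊤ := by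
  refine ae_lt_top (measurable_setLIntegral_intensity h.measurableSet hB hBR
    (g := fun u ω => Real.exp (m t u + Y t u ω)) (h.measurable_intensity ht)) ?_
  rw [h.lintegral_intensity hB hBR ht]
  exact (h.setLIntegral_lam_lt_top hB hBR ht).ne

theorem measurable_count {t : ℕ} (ht : 1 ≤ t) (hB : MeasurableSet B) :
    Measurable fun ω => (count (X t ω) B : ℝ) :=
  measurable_from_top.comp (h.cox.measurable_count t ht B hB)

theorem measurable_count_ennreal {t : ℕ} (ht : 1 ≤ t) (hB : MeasurableSet B) :
    Measurable fun ω => (count (X t ω) B : ℝ≥0∞) :=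
  measurable_from_top.comp (h.cox.measurable_count t ht B hB)

theorem lintegral_count (hB : MeasurableSet B) (hBR : B ⊆ R) {t : ℕ} (ht : 1 ≤ t) :
    ∫⁻ ω, (count (X t ω) B : ℝ≥0∞) ∂P = ∫⁻ u in B, ENNReal.ofReal (lam t u) := by
  rw [h.cox.lintegral_count_id h.measurableSet (fun t ht => h.measurable_intensity ht)
    (fun t u ω => (Real.exp_pos _).le) hB hBR ht (h.ae_setLIntegral_intensity_lt_top hB hBR ht),
    h.lintegral_intensity hB hBR ht]

theorem lintegral_count_sq_le (hB : MeasurableSet B) (hBR : B ⊆ R) {t : ℕ} (ht : 1 ≤ t) :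
    ∫⁻ ω, (count (X t ω) B : ℝ≥0∞) ^ 2 ∂P ≤ (∫⁻ u in B, ENNReal.ofReal (lam t u)) +
      ENNReal.ofReal (Real.exp V) * ((∫⁻ u in B, ENNReal.ofReal (lam t u)) *
        ∫⁻ u in B, ENNReal.ofReal (lam t u)) := by
  rw [h.cox.lintegral_count_sq h.measurableSet (fun t ht => h.measurable_intensity ht)
    (fun t u ω => (Real.exp_pos _).le) hB hBR ht (h.ae_setLIntegral_intensity_lt_top hB hBR ht),
    h.lintegral_intensity hB hBR ht]
  gcongr
  exact lintegral_mul_logIntensity_le h.gaussian h.measurableSet h.measurable_mean h.lam_eq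
    h.measurable_lam hB hBR ht ht fun u hu u' hu' => h.covariance_le ht ht hu hu'

theorem lintegral_count_mul {t s : ℕ} (hB : MeasurableSet B) (hBR : B ⊆ R) (ht : 1 ≤ t)
    (hs : 1 ≤ s) (hts : t ≠ s) :
    ∫⁻ ω, (count (X t ω) B : ℝ≥0∞) * (count (X s ω) B : ℝ≥0∞) ∂P =
      ∫⁻ ω, (∫⁻ u in B, ENNReal.ofReal (Real.exp (m t u + Y t u ω))) *
        (∫⁻ u in B, ENNReal.ofReal (Real.exp (m s u + Y s u ω))) ∂P :=
  h.cox.lintegral_count_mul h.measurableSet (fun t ht => h.measurable_intensity ht)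
    (fun t u ω => (Real.exp_pos _).le) hB hBR ht hs hts
    fun t ht => h.ae_setLIntegral_intensity_lt_top hB hBR ht

theorem memLp_count (hB : MeasurableSet B) (hBR : B ⊆ R) {t : ℕ} (ht : 1 ≤ t) :
    MemLp (fun ω => (count (X t ω) B : ℝ)) 2 P := by
  rw [memLp_two_iff_integrable_sq (h.measurable_count ht hB).aestronglyMeasurable]
  refine ⟨((h.measurable_count ht hB).pow_const 2).aestronglyMeasurable, ?_⟩
  rw [hasFiniteIntegral_iff_ofReal (.of_forall fun ω => sq_nonneg _)]
  have hA := h.setLIntegral_lam_lt_top hB hBR ht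
  refine lt_of_le_of_lt ?_ ((h.lintegral_count_sq_le hB hBR ht).trans_lt
    (ENNReal.add_lt_top.2 ⟨hA, ENNReal.mul_lt_top ENNReal.ofReal_lt_top
      (ENNReal.mul_lt_top hA hA)⟩))
  refine lintegral_mono fun ω => ?_
  rw [ENNReal.ofReal_pow (Nat.cast_nonneg _), ENNReal.ofReal_natCast]

theorem integral_count (hB : MeasurableSet B) (hBR : B ⊆ R) {t : ℕ} (ht : 1 ≤ t) :
    ∫ ω, (count (X t ω) B : ℝ) ∂P = ∫ u in B, lam t u := by
  rw [← h.toReal_setLIntegral_lam hBR t, ← h.lintegral_count hB hBR ht,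
    ← integral_toReal (h.measurable_count_ennreal ht hB).aemeasurable
      (.of_forall fun ω => ENNReal.natCast_lt_top _)]
  simp

theorem integral_count_mul_eq (hB : MeasurableSet B) {t s : ℕ} (ht : 1 ≤ t) (hs : 1 ≤ s) :
    ∫ ω, (count (X t ω) B : ℝ) * (count (X s ω) B : ℝ) ∂P =
      (∫⁻ ω, (count (X t ω) B : ℝ≥0∞) * (count (X s ω) B : ℝ≥0∞) ∂P).toReal := by
  have hm : Measurable fun ω => (count (X t ω) B : ℝ≥0∞) * (count (X s ω) B : ℝ≥0∞) :=
    (h.measurable_count_ennreal ht hB).mul (h.measurable_count_ennreal hs hB)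
  rw [← integral_toReal hm.aemeasurable (.of_forall fun ω => ENNReal.mul_lt_top (ENNReal.natCast_lt_top _)
        (ENNReal.natCast_lt_top _))]
  simp [ENNReal.toReal_mul]

theorem toReal_mul_setLIntegral_lam (hBR : B ⊆ R) (t s : ℕ) (c : ℝ) :
    (ENNReal.ofReal (Real.exp c) * ((∫⁻ u in B, ENNReal.ofReal (lam t u)) *
        ∫⁻ u in B, ENNReal.ofReal (lam s u))).toReal =
      Real.exp c * ((∫ u in B, lam t u) * ∫ u in B, lam s u) := by
  rw [ENNReal.toReal_mul, ENNReal.toReal_mul, ENNReal.toReal_ofReal (Real.exp_pos c).le,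
    h.toReal_setLIntegral_lam hBR, h.toReal_setLIntegral_lam hBR]

theorem mul_setLIntegral_lam_ne_top (hB : MeasurableSet B) (hBR : B ⊆ R) {t s : ℕ} (ht : 1 ≤ t)
    (hs : 1 ≤ s) (c : ℝ) :
    ENNReal.ofReal (Real.exp c) * ((∫⁻ u in B, ENNReal.ofReal (lam t u)) *
        ∫⁻ u in B, ENNReal.ofReal (lam s u)) ≠ ⊤ :=
  (ENNReal.mul_lt_top ENNReal.ofReal_lt_top (ENNReal.mul_lt_top
    (h.setLIntegral_lam_lt_top hB hBR ht) (h.setLIntegral_lam_lt_top hB hBR hs))).ne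

theorem integral_count_sq_le (hB : MeasurableSet B) (hBR : B ⊆ R) {t : ℕ} (ht : 1 ≤ t) :
    ∫ ω, (count (X t ω) B : ℝ) * (count (X t ω) B : ℝ) ∂P ≤
      (∫ u in B, lam t u) + Real.exp V * ((∫ u in B, lam t u) * ∫ u in B, lam t u) := by
  have hA := (h.setLIntegral_lam_lt_top hB hBR ht).ne
  have hM := h.mul_setLIntegral_lam_ne_top hB hBR ht ht V
  rw [h.integral_count_mul_eq hB ht ht, ← h.toReal_mul_setLIntegral_lam hBR,
    ← h.toReal_setLIntegral_lam hBR, ← ENNReal.toReal_add hA hM]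
  refine ENNReal.toReal_mono (ENNReal.add_ne_top.2 ⟨hA, hM⟩) ?_
  simp_rw [← sq]
  simpa only [sq] using h.lintegral_count_sq_le hB hBR ht

theorem integral_count_mul_le (hB : MeasurableSet B) (hBR : B ⊆ R) {t s : ℕ} (ht : 1 ≤ t)
    (hs : 1 ≤ s) (hts : t ≠ s) {c : ℝ} (hc : ∀ u ∈ R, ∀ u' ∈ R, cov[Y t u, Y s u'; P] ≤ c) :
    ∫ ω, (count (X t ω) B : ℝ) * (count (X s ω) B : ℝ) ∂P ≤
      Real.exp c * ((∫ u in B, lam t u) * ∫ u in B, lam s u) := by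
  rw [h.integral_count_mul_eq hB ht hs, ← h.toReal_mul_setLIntegral_lam hBR,
    h.lintegral_count_mul hB hBR ht hs hts]
  exact ENNReal.toReal_mono (h.mul_setLIntegral_lam_ne_top hB hBR ht hs c)
    (lintegral_mul_logIntensity_le h.gaussian h.measurableSet h.measurable_mean h.lam_eq
      h.measurable_lam hB hBR ht hs hc)

theorem le_integral_count_mul (hB : MeasurableSet B) (hBR : B ⊆ R) {t s : ℕ} (ht : 1 ≤ t)
    (hs : 1 ≤ s) (hts : t ≠ s) {c : ℝ} (hc : ∀ u ∈ R, ∀ u' ∈ R, c ≤ cov[Y t u, Y s u'; P]) :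
    Real.exp c * ((∫ u in B, lam t u) * ∫ u in B, lam s u) ≤
      ∫ ω, (count (X t ω) B : ℝ) * (count (X s ω) B : ℝ) ∂P := by
  rw [h.integral_count_mul_eq hB ht hs, ← h.toReal_mul_setLIntegral_lam hBR,
    h.lintegral_count_mul hB hBR ht hs hts]
  -- Monotonicity of `toReal` needs the larger side finite; the upper bound with the constant V
  -- supplies this.
  refine ENNReal.toReal_mono (ne_top_of_le_ne_top
    (h.mul_setLIntegral_lam_ne_top hB hBR ht hs V) ?_)
    (le_lintegral_mul_logIntensity h.gaussian h.measurableSet h.measurable_mean h.lam_eq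
      h.measurable_lam hB hBR ht hs hc)
  exact lintegral_mul_logIntensity_le h.gaussian h.measurableSet h.measurable_mean h.lam_eq
      h.measurable_lam hB hBR ht hs fun u hu u' hu' => h.covariance_le ht hs hu hu'

theorem integral_centered_mul (hB : MeasurableSet B) (hBR : B ⊆ R) {t s : ℕ} (ht : 1 ≤ t)
    (hs : 1 ≤ s) :
    ∫ ω, ((count (X t ω) B : ℝ) - ∫ u in B, lam t u) *
        ((count (X s ω) B : ℝ) - ∫ u in B, lam s u) ∂P =
      (∫ ω, (count (X t ω) B : ℝ) * (count (X s ω) B : ℝ) ∂P) -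
        (∫ u in B, lam t u) * ∫ u in B, lam s u := by
  have hc := covariance_eq_sub (h.memLp_count hB hBR ht) (h.memLp_count hB hBR hs)
  rw [covariance, h.integral_count hB hBR ht, h.integral_count hB hBR hs] at hc
  simpa using hc

/-- A crude bound, uniform in both times, for the pairs at small lag. The linear term is the Poisson
variance, present only when t = s. -/
theorem abs_integral_centered_mul_le (hB : MeasurableSet B) (hBR : B ⊆ R) {t s : ℕ} (ht : 1 ≤ t)
    (hs : 1 ≤ s) :
    |∫ ω, ((count (X t ω) B : ℝ) - ∫ u in B, lam t u) *
        ((count (X s ω) B : ℝ) - ∫ u in B, lam s u) ∂P| ≤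
      L * volume.real R + (Real.exp V + 1) * (L * volume.real R) ^ 2 := by
  rw [h.integral_centered_mul hB hBR ht hs]
  have ht0 := h.setIntegral_lam_nonneg (B := B) t
  have hs0 := h.setIntegral_lam_nonneg (B := B) s
  have ht1 := h.setIntegral_lam_le hBR ht
  have hs1 := h.setIntegral_lam_le hBR hs
  have h0 : 0 ≤ ∫ ω, (count (X t ω) B : ℝ) * (count (X s ω) B : ℝ) ∂P :=
    integral_nonneg fun ω => by positivity
  have hV := Real.exp_pos V
  have hprod : (∫ u in B, lam t u) * (∫ u in B, lam s u) ≤ (L * volume.real R) ^ 2 := by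
    rw [sq]; gcongr
    exact ht0.trans ht1
  have hprod0 := mul_nonneg ht0 hs0
  have hup : ∫ ω, (count (X t ω) B : ℝ) * (count (X s ω) B : ℝ) ∂P ≤
      L * volume.real R + Real.exp V * (L * volume.real R) ^ 2 := by
    have hVp := mul_le_mul_of_nonneg_left hprod hV.le
    by_cases hts : t = s
    · subst hts
      linarith [h.integral_count_sq_le hB hBR ht]
    · linarith [h.integral_count_mul_le hB hBR ht hs hts
        fun u hu u' hu' => h.covariance_le ht hs hu hu']
  rw [abs_le]
  constructor <;> nlinarith

/-- Once |cov(Y_t, Y_s)| < c on R × R, the mixed moment of the counts lies between exp(-c) and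
exp(c) times the product of the means, so the covariance is at most 2c times that product. -/
theorem abs_integral_centered_mul_le_of_lag (hB : MeasurableSet B) (hBR : B ⊆ R) {ε : ℝ}
    (hε : 0 < ε) :
    ∃ K : ℕ, ∀ t s, 1 ≤ t → t + K ≤ s →
      |∫ ω, ((count (X t ω) B : ℝ) - ∫ u in B, lam t u) *
        ((count (X s ω) B : ℝ) - ∫ u in B, lam s u) ∂P| ≤ ε := by
  set M := (L * volume.real R) ^ 2
  have hM : 0 ≤ M := sq_nonneg _
  -- c ≤ 1 permits |exp x - 1| ≤ 2|x| at x = ±c, and the second bound gives 2cM ≤ ε; the summand 1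
  -- covers M = 0.
  set c := min 1 (ε / (2 * (M + 1)))
  have hc0 : 0 < c := lt_min one_pos (by positivity)
  have hcM : 2 * c * M ≤ ε := by
    have : c ≤ ε / (2 * (M + 1)) := min_le_right _ _
    rw [le_div_iff₀ (by positivity)] at this
    nlinarith
  obtain ⟨K, hK⟩ := eventually_atTop.1 (Metric.tendstoUniformlyOn_iff.1 h.autocov_tendsto c hc0)
  -- The extra 1 ensures t ≠ s, so that no Poisson variance enters.
  refine ⟨K + 1, fun t s ht hts => ?_⟩
  have hs : 1 ≤ s := by omega
  have hcov : ∀ u ∈ R, ∀ u' ∈ R, |cov[Y t u, Y s u'; P]| < c := by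
    intro u hu u' hu'
    have h1 := hK (s - t) (by omega) (u, u') ⟨hu, hu'⟩
    rw [Pi.zero_apply, dist_zero_left, Real.norm_eq_abs,
      ← h.gaussian.autocov t ht (s - t) u hu u' hu', Nat.add_sub_cancel' (by omega)] at h1
    exact h1
  have hup := h.integral_count_mul_le hB hBR ht hs (by omega)
    fun u hu u' hu' => (abs_lt.1 (hcov u hu u' hu')).2.le
  have hlo := h.le_integral_count_mul hB hBR ht hs (by omega)
    fun u hu u' hu' => (abs_lt.1 (hcov u hu u' hu')).1.le
  have ht0 := h.setIntegral_lam_nonneg (B := B) t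
  have hs0 := h.setIntegral_lam_nonneg (B := B) s
  have ht1 := h.setIntegral_lam_le hBR ht
  have hprod : (∫ u in B, lam t u) * (∫ u in B, lam s u) ≤ M := by
    simp only [M]
    rw [sq]
    gcongr
    exacts [ht0.trans ht1, h.setIntegral_lam_le hBR hs]
  have hprod0 := mul_nonneg ht0 hs0
  have he : ∀ x : ℝ, |x| = c → |Real.exp x - 1| ≤ 2 * c := fun x hx => by
    have := Real.abs_exp_sub_one_le (x := x) (hx.trans_le (min_le_left _ _))
    rwa [hx] at this
  have he1 := abs_le.1 (he c (abs_of_pos hc0))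
  have he2 := abs_le.1 (he (-c) (by rw [abs_neg, abs_of_pos hc0]))
  rw [h.integral_centered_mul hB hBR ht hs, abs_le]
  have h2 : 2 * c * ((∫ u in B, lam t u) * (∫ u in B, lam s u)) ≤ ε :=
    (mul_le_mul_of_nonneg_left hprod (by positivity)).trans hcM
  have h3 := mul_le_mul_of_nonneg_right he1.2 hprod0
  have h4 := mul_le_mul_of_nonneg_right he2.1 hprod0
  constructor <;> linarith

/-- Weak law of large numbers for the weighted counts in a set. -/
theorem tendstoInMeasure_count (hB : MeasurableSet B) (hBR : B ⊆ R) {w : ℕ → ℝ} {W : ℝ}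
    (hw : ∀ t, |w t| ≤ W) :
    TendstoInMeasure P (fun (n : ℕ) ω => (1 / (n : ℝ)) * ∑ t ∈ Finset.Icc 1 n,
      w t * ((count (X t ω) B : ℝ) - ∫ u in B, lam t u)) atTop fun _ => 0 := by
  have hW : 0 ≤ W := (abs_nonneg _).trans (hw 0)
  have hle : ∀ t s, ∀ e, |∫ ω, ((count (X t ω) B : ℝ) - ∫ u in B, lam t u) *
        ((count (X s ω) B : ℝ) - ∫ u in B, lam s u) ∂P| ≤ e →
      ∫ ω, w t * ((count (X t ω) B : ℝ) - ∫ u in B, lam t u) *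
        (w s * ((count (X s ω) B : ℝ) - ∫ u in B, lam s u)) ∂P ≤ W ^ 2 * e := by
    intro t s e hts
    simp_rw [mul_mul_mul_comm (w t)]
    rw [integral_const_mul]
    refine (le_abs_self _).trans ?_
    rw [abs_mul, abs_mul, sq]
    gcongr <;> apply hw
  refine tendstoInMeasure_average
    (fun t ht => ((h.memLp_count hB hBR ht).sub (memLp_const _)).const_mul (w t))
    (fun t s ht hs => hle t s _ (h.abs_integral_centered_mul_le hB hBR ht hs)) fun ε hε => ?_
  obtain ⟨K, hK⟩ := h.abs_integral_centered_mul_le_of_lag hB hBR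
    (ε := ε / (W ^ 2 + 1)) (by positivity)
  refine ⟨K, fun t s ht hts => (hle t s _ (hK t s ht hts)).trans ?_⟩
  rw [mul_div_assoc', div_le_iff₀ (by positivity)]
  nlinarith

/-- Weak law of large numbers for the weighted sums of a bounded function over the points. -/
theorem tendstoInMeasure_sum {φ : E → ℝ} (hφ : Measurable fun u : R => φ u) {C : ℝ}
    (hC : ∀ u ∈ R, |φ u| ≤ C) {w : ℕ → ℝ} {W : ℝ} (hw : ∀ t, |w t| ≤ W) :
    TendstoInMeasure P (fun (n : ℕ) ω => (1 / (n : ℝ)) * ∑ t ∈ Finset.Icc 1 n,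
      w t * ((∑ u ∈ X t ω, φ u) - ∫ u in R, φ u * lam t u)) atTop fun _ => 0 := by
  have hW : 0 ≤ W := (abs_nonneg _).trans (hw 0)
  have hR := h.measurableSet
  set M := |L| * volume.real R with hMdef
  have hM : 0 ≤ M := by positivity
  refine tendstoInMeasure_zero_of_forall_subset fun δ hδ => ?_
  -- Replacing φ by its simple approximation costs at most W * e times the average count plus the
  -- average mean. With this e the cost is at most δ/2 as long as those averages sum to at most 2M +
  -- 1.
  set e := δ / (2 * ((W + 1) * (2 * M + 1))) with hedef
  have he : 0 < e := by positivity
  obtain ⟨I, c, B, hB, hBR, hap⟩ := exists_simple_approx hR hφ hC he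
  have h1 := tendstoInMeasure_zero_sum (P := P) I fun i _ => tendstoInMeasure_zero_const_mul
    (h.tendstoInMeasure_count (hB i) (hBR i) hw) (c i)
  -- The law for the total count keeps the average count below M + 1 outside an event of vanishing
  -- probability.
  have h2 := h.tendstoInMeasure_count hR le_rfl (w := fun _ => 1) (W := 1) (by simp)
  refine ⟨_, tendsto_measure_union_zero (tendsto_measure_of_tendstoInMeasure_zero h1 (half_pos hδ))
    (tendsto_measure_of_tendstoInMeasure_zero h2 one_pos), ?_⟩
  filter_upwards [eventually_ge_atTop 1] with n hn ω hω
  have hn0 : (0 : ℝ) < n := by exact_mod_cast hn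
  simp only [Set.mem_ofPred_eq, Set.mem_union, one_mul] at hω ⊢
  by_contra! hcon
  obtain ⟨hc1, hc2⟩ := hcon
  have hterm : ∀ t ∈ Finset.Icc 1 n,
      |((∑ u ∈ X t ω, φ u) - ∫ u in R, φ u * lam t u) -
        ∑ i ∈ I, c i * ((count (X t ω) (B i) : ℝ) - ∫ u in B i, lam t u)| ≤
      e * ((count (X t ω) R : ℝ) + ∫ u in R, lam t u) := by
    intro t ht
    have ht1 := (Finset.mem_Icc.1 ht).1
    have hcount : |(∑ u ∈ X t ω, φ u) - ∑ i ∈ I, c i * (count (X t ω) (B i) : ℝ)| ≤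
        e * (count (X t ω) R : ℝ) := by
      simp_rw [count_eq_sum, Finset.mul_sum]
      rw [Finset.sum_comm, ← Finset.sum_sub_distrib]
      refine (Finset.abs_sum_le_sum_abs _ _).trans (Finset.sum_le_sum fun u hu => ?_)
      have huR : u ∈ R := h.cox.subset t ht1 ω hu
      rw [Set.indicator_of_mem huR, mul_one]
      exact hap u huR
    have hlamR := h.integrableOn_lam hR le_rfl ht1
    have hφlam : IntegrableOn (fun u => φ u * lam t u) R := by
      refine Integrable.bdd_mul (c := C) hlamR
        (aemeasurable_restrict_of_subset hR le_rfl hφ).aestronglyMeasurable ?_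
      exact (ae_restrict_mem hR).mono hC
    have hBlam : ∀ i, IntegrableOn
        (fun u => c i * (B i).indicator (fun _ => (1 : ℝ)) u * lam t u) R := by
      intro i
      refine (hlamR.indicator (hB i)).const_mul (c i) |>.congr (.of_forall fun u => ?_)
      by_cases hu : u ∈ B i <;> simp [hu]
    have hBint : ∀ i, ∫ u in R, c i * (B i).indicator (fun _ => (1 : ℝ)) u * lam t u =
        c i * ∫ u in B i, lam t u := by
      intro i
      rw [← integral_const_mul, ← Set.inter_eq_self_of_subset_right (hBR i),
        ← setIntegral_indicator (hB i), Set.inter_eq_self_of_subset_right (hBR i)]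
      refine integral_congr_ae (.of_forall fun u => ?_)
      by_cases hu : u ∈ B i <;> simp [hu]
    have hint : |(∫ u in R, φ u * lam t u) - ∑ i ∈ I, c i * ∫ u in B i, lam t u| ≤
        e * ∫ u in R, lam t u := by
      simp_rw [← hBint]
      rw [← integral_finsetSum _ fun i _ => hBlam i,
        ← integral_sub hφlam (integrable_finsetSum _ fun i _ => hBlam i), ← integral_const_mul,
        ← Real.norm_eq_abs]
      refine norm_integral_le_of_norm_le (hlamR.const_mul e)
        ((ae_restrict_mem hR).mono fun u hu => ?_)
      rw [← Finset.sum_mul, ← sub_mul, norm_mul, Real.norm_eq_abs, Real.norm_eq_abs,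
        abs_of_nonneg (h.lam_nonneg t u)]
      exact mul_le_mul_of_nonneg_right (hap u hu) (h.lam_nonneg t u)
    simp_rw [mul_sub]
    rw [Finset.sum_sub_distrib, mul_add]
    calc _ = |((∑ u ∈ X t ω, φ u) - ∑ i ∈ I, c i * (count (X t ω) (B i) : ℝ)) -
          ((∫ u in R, φ u * lam t u) - ∑ i ∈ I, c i * ∫ u in B i, lam t u)| := by congr 1; ring
      _ ≤ _ := (abs_sub _ _).trans (add_le_add hcount hint)
  have hdiff : |(1 / (n : ℝ)) * ∑ t ∈ Finset.Icc 1 n,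
        w t * ((∑ u ∈ X t ω, φ u) - ∫ u in R, φ u * lam t u) -
      ∑ i ∈ I, c i * ((1 / (n : ℝ)) * ∑ t ∈ Finset.Icc 1 n,
        w t * ((count (X t ω) (B i) : ℝ) - ∫ u in B i, lam t u))| ≤
      (1 / (n : ℝ)) * ∑ t ∈ Finset.Icc 1 n,
        W * (e * ((count (X t ω) R : ℝ) + ∫ u in R, lam t u)) := by
    have hswap : ∑ i ∈ I, c i * ((1 / (n : ℝ)) * ∑ t ∈ Finset.Icc 1 n,
        w t * ((count (X t ω) (B i) : ℝ) - ∫ u in B i, lam t u)) =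
        (1 / (n : ℝ)) * ∑ t ∈ Finset.Icc 1 n, w t *
          ∑ i ∈ I, c i * ((count (X t ω) (B i) : ℝ) - ∫ u in B i, lam t u) := by
      simp_rw [Finset.mul_sum]
      rw [Finset.sum_comm]
      refine Finset.sum_congr rfl fun t _ => Finset.sum_congr rfl fun i _ => by ring
    rw [hswap, ← mul_sub, ← Finset.sum_sub_distrib, abs_mul, abs_of_pos (by positivity)]
    refine mul_le_mul_of_nonneg_left ((Finset.abs_sum_le_sum_abs _ _).trans
      (Finset.sum_le_sum fun t ht => ?_)) (by positivity)
    rw [← mul_sub, abs_mul]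
    exact mul_le_mul (hw t) (hterm t ht) (abs_nonneg _) hW
  have hmean : (1 / (n : ℝ)) * ∑ t ∈ Finset.Icc 1 n, ∫ u in R, lam t u ≤ M := by
    rw [one_div, inv_mul_le_iff₀ hn0]
    refine (Finset.sum_le_card_nsmul _ _ M fun t ht => ?_).trans (by simp)
    refine (h.setIntegral_lam_le le_rfl (Finset.mem_Icc.1 ht).1).trans ?_
    rw [hMdef]
    gcongr
    exact le_abs_self L
  have hc2' := (abs_lt.1 hc2).2
  rw [Finset.sum_sub_distrib, mul_sub] at hc2'
  rw [← Finset.mul_sum, ← Finset.mul_sum, Finset.sum_add_distrib] at hdiff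
  have hbound : (1 / (n : ℝ)) * (W * (e * (∑ t ∈ Finset.Icc 1 n, (count (X t ω) R : ℝ) +
      ∑ t ∈ Finset.Icc 1 n, ∫ u in R, lam t u))) ≤ W * e * (2 * M + 1) := by
    have : (1 / (n : ℝ)) * (∑ t ∈ Finset.Icc 1 n, (count (X t ω) R : ℝ) +
      ∑ t ∈ Finset.Icc 1 n, ∫ u in R, lam t u) ≤ 2 * M + 1 := by rw [mul_add]; linarith
    calc _ = W * e * ((1 / (n : ℝ)) * (∑ t ∈ Finset.Icc 1 n, (count (X t ω) R : ℝ) +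
            ∑ t ∈ Finset.Icc 1 n, ∫ u in R, lam t u)) := by ring
      _ ≤ _ := mul_le_mul_of_nonneg_left this (by positivity)
  have hfin : W * e * (2 * M + 1) ≤ δ / 2 := by
    rw [hedef]
    have : W * (δ / (2 * ((W + 1) * (2 * M + 1)))) * (2 * M + 1) = W / (W + 1) * (δ / 2) := by
      field_simp
    rw [this]
    have hW1 : W / (W + 1) ≤ 1 := by rw [div_le_one (by positivity)]; linarith
    nlinarith
  have := abs_sub_abs_le_abs_sub ((1 / (n : ℝ)) * ∑ t ∈ Finset.Icc 1 n,
        w t * ((∑ u ∈ X t ω, φ u) - ∫ u in R, φ u * lam t u))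
      (∑ i ∈ I, c i * ((1 / (n : ℝ)) * ∑ t ∈ Finset.Icc 1 n,
        w t * ((count (X t ω) (B i) : ℝ) - ∫ u in B i, lam t u)))
  linarith

end IsLogGaussianCoxSeries

end Counts

/-! ### Localizing the maximizers of a concave function -/

section Concave

variable {V : Type*} [NormedAddCommGroup V] [NormedSpace ℝ V] {f : V → ℝ} {x₀ : V} {ε : ℝ}

/-- A concave function that is smaller on a sphere than at its centre is smaller outside it too. -/
theorem lt_of_lt_on_sphere (hf : ConcaveOn ℝ Set.univ f) (hε : 0 < ε)
    (hlt : ∀ h : V, ‖h‖ = ε → f (x₀ + h) < f x₀) {x : V} (hx : ε ≤ ‖x - x₀‖) : f x < f x₀ := by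
  have hpos : 0 < ‖x - x₀‖ := hε.trans_le hx
  -- The point (1 - s) x₀ + s x lies on the sphere, so concavity gives (1 - s) f x₀ + s f x < f x₀.
  set s := ε / ‖x - x₀‖
  have hs0 : 0 < s := by positivity
  have hs1 : s ≤ 1 := (div_le_one hpos).2 hx
  have h1 := hlt (s • (x - x₀)) (by
    rw [norm_smul, Real.norm_eq_abs, abs_of_pos hs0]
    exact div_mul_cancel₀ ε hpos.ne')
  have h2 := hf.2 (Set.mem_univ x₀) (Set.mem_univ x) (sub_nonneg.2 hs1) hs0.le (by ring)
  have h3 : (1 - s) • x₀ + s • x = x₀ + s • (x - x₀) := by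
    rw [smul_sub, sub_smul, one_smul]; abel
  rw [h3, smul_eq_mul, smul_eq_mul] at h2
  nlinarith

/-- A maximizer over the compact ball is global. Existence matters because the estimator is
arbitrary when there is no maximizer. -/
theorem exists_isMaxOn_of_lt_on_sphere [FiniteDimensional ℝ V]
    (hf : ConcaveOn ℝ Set.univ f) (hε : 0 < ε)
    (hlt : ∀ h : V, ‖h‖ = ε → f (x₀ + h) < f x₀) : ∃ x, IsMaxOn f Set.univ x := by
  have hcont : ContinuousOn f Set.univ := hf.continuousOn isOpen_univ
  obtain ⟨z, hz, hmax⟩ := (isCompact_closedBall x₀ ε).exists_isMaxOn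
    ⟨x₀, Metric.mem_closedBall_self hε.le⟩ (hcont.mono (Set.subset_univ _))
  refine ⟨z, fun x _ => ?_⟩
  by_cases hx : x ∈ Metric.closedBall x₀ ε
  · exact hmax hx
  · rw [Metric.mem_closedBall, dist_eq_norm, not_le] at hx
    exact ((lt_of_lt_on_sphere hf hε hlt hx.le).trans_le
      (hmax (Metric.mem_closedBall_self hε.le))).le

theorem norm_sub_lt_of_isMaxOn (hf : ConcaveOn ℝ Set.univ f) (hε : 0 < ε)
    (hlt : ∀ h : V, ‖h‖ = ε → f (x₀ + h) < f x₀) {x : V} (hx : IsMaxOn f Set.univ x) :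
    ‖x - x₀‖ < ε := by
  by_contra! h
  exact (lt_of_lt_on_sphere hf hε hlt h).not_ge (hx (Set.mem_univ x₀))

end Concave

/-! ### Averages of periodic sequences -/

section Periodic

theorem sum_range_mul_of_periodic {g : ℕ → ℝ} {r : ℕ} (hg : ∀ t, g (t + r) = g t) (k : ℕ) :
    ∑ t ∈ Finset.range (k * r), g t = k * ∑ t ∈ Finset.range r, g t := by
  induction k with
  | zero => simp
  | succ k ih =>
    have hper : ∀ k t, g (k * r + t) = g t := by
      intro k
      induction k with
      | zero => simp
      | succ k ih' =>
        intro t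
        rw [show (k + 1) * r + t = k * r + t + r by ring, hg, ih']
    rw [Nat.succ_mul, Finset.sum_range_add, ih]
    simp_rw [hper]
    push_cast
    ring

theorem sum_Icc_eq_sum_range (g : ℕ → ℝ) (n : ℕ) :
    ∑ t ∈ Finset.Icc 1 n, g t = ∑ t ∈ Finset.range n, g (t + 1) := by
  rw [Finset.range_eq_Ico, Finset.sum_Ico_add', ← Finset.Ico_add_one_right_eq_Icc, zero_add]

/-- The averages of a nonnegative periodic sequence are bounded below by half its mean. -/
theorem le_average_of_periodic {g : ℕ → ℝ} {r : ℕ} (hr : 0 < r) (hg : ∀ t, g (t + r) = g t)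
    (h0 : ∀ t, 0 ≤ g t) {n : ℕ} (hn : r ≤ n) :
    (1 / (2 * r : ℝ)) * ∑ t ∈ Finset.Icc 1 r, g t ≤
      (1 / (n : ℝ)) * ∑ t ∈ Finset.Icc 1 n, g t := by
  rw [sum_Icc_eq_sum_range, sum_Icc_eq_sum_range]
  set g' : ℕ → ℝ := fun t => g (t + 1)
  have hr0 : (0 : ℝ) < r := by exact_mod_cast hr
  have hn0 : (0 : ℝ) < n := by exact_mod_cast hr.trans_le hn
  have hS : 0 ≤ ∑ t ∈ Finset.range r, g' t := Finset.sum_nonneg fun t _ => h0 _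
  have h1 : ((n / r : ℕ) : ℝ) * ∑ t ∈ Finset.range r, g' t ≤ ∑ t ∈ Finset.range n, g' t := by
    rw [← sum_range_mul_of_periodic (g := g') (fun t => by
      simp only [g']; rw [show t + r + 1 = t + 1 + r by ring, hg])]
    exact Finset.sum_le_sum_of_subset_of_nonneg
      (Finset.range_mono (Nat.div_mul_le_self n r)) fun t _ _ => h0 _
  -- The incomplete last period is dropped; as there is at least one full period, this loses at most
  -- a factor 2.
  have h2 : (n : ℝ) ≤ 2 * r * (n / r : ℕ) := by
    have h3 : 1 ≤ n / r := (Nat.one_le_div_iff hr).2 hn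
    have h4 := Nat.lt_mul_div_succ n hr
    have h5 : n ≤ 2 * r * (n / r) := by nlinarith
    exact_mod_cast h5
  rw [one_div, one_div, inv_mul_le_iff₀ (by positivity), mul_left_comm, ← div_eq_inv_mul,
    le_div_iff₀ hn0]
  nlinarith [mul_le_mul_of_nonneg_right h2 hS]

end Periodic

/-! ### Zeros of the trend polynomial -/

section Trend

open Polynomial in
/-- The polynomial `∑ η_k x^(k+1)`. -/
def trendPoly {q : ℕ} (η : Fin q → ℝ) : ℝ[X] := ∑ k : Fin q, monomial (k.val + 1) (η k)

theorem eval_trendPoly {q : ℕ} (η : Fin q → ℝ) (x : ℝ) :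
    (trendPoly η).eval x = η ⬝ᵥ trendBasis q (x + 1) := by
  simp [trendPoly, Polynomial.eval_finsetSum, dotProduct, trendBasis]

theorem natDegree_trendPoly_le {q : ℕ} (η : Fin q → ℝ) : (trendPoly η).natDegree ≤ q :=
  Polynomial.natDegree_sum_le_of_forall_le _ _ fun k _ =>
    (Polynomial.natDegree_monomial_le _).trans k.2

theorem eq_zero_of_trendPoly_eq_zero {q : ℕ} {η : Fin q → ℝ} (h : trendPoly η = 0) : η = 0 := by
  funext k
  have := congrArg (fun f => Polynomial.coeff f (k.val + 1)) h
  simpa [trendPoly, Polynomial.finsetSum_coeff, Polynomial.coeff_monomial, Fin.val_inj] using this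

theorem polynomial_eq_zero_of_eval_nat_eq_zero {f : Polynomial ℝ} {N : ℕ} (hf : f.natDegree < N)
    (h : ∀ i : ℕ, i < N → f.eval (i : ℝ) = 0) : f = 0 :=
  Polynomial.eq_zero_of_natDegree_lt_card_of_eval_eq_zero f (f := fun i : Fin N => (i.val : ℝ))
    (fun i j hij => Fin.ext (Nat.cast_injective (R := ℝ) hij)) (fun i => h i i.2) (by simpa using hf)

/-- A polynomial without constant term that is `d`-periodic at sufficiently many points is zero. -/
theorem polynomial_eq_zero_of_periodic {f : Polynomial ℝ} {N d : ℕ} (hd : 0 < d)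
    (hf : f.natDegree ≤ N) (h0 : f.eval 0 = 0)
    (h : ∀ i : ℕ, i < N → f.eval ((i : ℝ) + d) = f.eval (i : ℝ)) : f = 0 := by
  by_contra hne
  -- The shift keeps degree and leading coefficient, so the difference has degree below N and its N
  -- zeros suffice. Hence f is d-periodic everywhere and vanishes at all multiples of d.
  have hD : Polynomial.taylor (d : ℝ) f - f = 0 := by
    by_contra hDne
    have hdeg := Polynomial.degree_sub_lt_right (Polynomial.degree_taylor f (d : ℝ)) hne
      (Polynomial.leadingCoeff_taylor (f := f) (r := (d : ℝ)))
    refine hDne (polynomial_eq_zero_of_eval_nat_eq_zero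
      ((Polynomial.natDegree_lt_natDegree hDne hdeg).trans_le hf) fun i hi => ?_)
    rw [Polynomial.eval_sub, Polynomial.taylor_eval, h i hi, sub_self]
  have hper : ∀ x : ℝ, f.eval (x + d) = f.eval x := fun x => by
    rw [← Polynomial.taylor_eval, sub_eq_zero.1 hD]
  have hroot : ∀ n : ℕ, f.eval ((n : ℝ) * d) = 0 := by
    intro n
    induction n with
    | zero => simpa using h0
    | succ n ih => rw [Nat.cast_succ, add_one_mul, hper, ih]
  refine hne (Polynomial.eq_zero_of_infinite_isRoot f
    (Set.infinite_of_injective_forall_mem (f := fun n : ℕ => (n : ℝ) * d) (fun a b hab => ?_) hroot))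
  have hd' : (d : ℝ) ≠ 0 := by exact_mod_cast hd.ne'
  exact_mod_cast mul_right_cancel₀ hd' hab

end Trend

/-! ### Periodicity, linearity and boundedness of the mean function -/

section Mean

variable {E : Type*} {d p q : ℕ} [NeZero d] {r : ℕ} {β : E → Fin p → ℝ}

theorem residue_add_self (r t : ℕ) : residue r (t + r) = residue r t := by simp [residue]

theorem residue_add_of_dvd {d r : ℕ} (hdr : d ∣ r) (t : ℕ) : residue d (t + r) = residue d t := by
  obtain ⟨k, rfl⟩ := hdr
  simp [residue]

theorem residue_of_mem {r t : ℕ} (ht : t ∈ Finset.Icc 1 r) : residue r t = t := by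
  rw [Finset.mem_Icc] at ht
  unfold residue
  rcases ht.2.eq_or_lt with rfl | h
  · simp
  · rw [Nat.mod_eq_of_lt h, if_neg (by omega)]

theorem season_coe (j : Season d) : season d j = j := Subtype.ext (residue_of_mem j.2)

theorem meanFn_add_period (hdr : d ∣ r) (ϑ : Param d p q) (t : ℕ) (u : E) :
    meanFn r β ϑ (t + r) u = meanFn r β ϑ t u := by
  have : season d (t + r) = season d t := Subtype.ext (residue_add_of_dvd hdr t)
  rw [meanFn, meanFn, this, residue_add_self]

theorem meanFn_add (ϑ ϑ' : Param d p q) (t : ℕ) (u : E) :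
    meanFn r β (ϑ + ϑ') t u = meanFn r β ϑ t u + meanFn r β ϑ' t u := by
  simp only [meanFn, Prod.fst_add, Prod.snd_add, Pi.add_apply, add_dotProduct]
  ring

theorem meanFn_smul (a : ℝ) (ϑ : Param d p q) (t : ℕ) (u : E) :
    meanFn r β (a • ϑ) t u = a * meanFn r β ϑ t u := by
  simp only [meanFn, Prod.smul_fst, Prod.smul_snd, Pi.smul_apply, smul_dotProduct, smul_eq_mul]
  ring

theorem abs_trendBasis_residue_le (hr : 0 < r) (t : ℕ) (k : Fin q) :
    |trendBasis q (residue r t) k| ≤ (r : ℝ) ^ (k.val + 1) := by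
  have h := Finset.mem_Icc.1 (residue_mem r t hr)
  have h1 : (1 : ℝ) ≤ residue r t := by exact_mod_cast h.1
  have h2 : (residue r t : ℝ) ≤ r := by exact_mod_cast h.2
  rw [trendBasis, abs_pow, abs_of_nonneg (by linarith)]
  gcongr
  linarith

theorem abs_dotProduct_le {n : ℕ} (a b : Fin n → ℝ) {c : Fin n → ℝ} (hb : ∀ k, |b k| ≤ c k) :
    |a ⬝ᵥ b| ≤ ‖a‖ * ∑ k, c k := by
  rw [dotProduct, Finset.mul_sum]
  refine (Finset.abs_sum_le_sum_abs _ _).trans (Finset.sum_le_sum fun k _ => ?_)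
  rw [abs_mul]
  gcongr
  · exact norm_le_pi_norm a k
  · exact hb k

/-- The mean function is bounded on `R`, uniformly in time. -/
theorem exists_abs_meanFn_le (hr : 0 < r) {R : Set E}
    (hβb : ∃ C : ℝ, ∀ u ∈ R, ∀ k, |β u k| ≤ C) (ϑ : Param d p q) :
    ∃ M : ℝ, ∀ t, ∀ u ∈ R, |meanFn r β ϑ t u| ≤ M := by
  obtain ⟨C, hC⟩ := hβb
  refine ⟨‖ϑ.1‖ * (∑ _k : Fin p, |C|) + ‖ϑ.2‖ * ∑ k : Fin q, (r : ℝ) ^ (k.val + 1),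
    fun t u hu => ?_⟩
  refine (abs_add_le _ _).trans (add_le_add ((abs_dotProduct_le _ _
    fun k => (hC u hu k).trans (le_abs_self C)).trans ?_)
    (abs_dotProduct_le _ _ fun k => abs_trendBasis_residue_le hr t k))
  gcongr
  exact norm_le_pi_norm ϑ.1 _

variable [MeasureSpace E] {R : Set E}

theorem measurable_dotProduct_basis (hβ : Measurable fun u : R => β u) (a : Fin p → ℝ) :
    Measurable fun u : R => a ⬝ᵥ β u := by
  simp only [dotProduct]
  exact Finset.measurable_sum _ fun k _ => ((measurable_pi_iff.1 hβ) k).const_mul _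

theorem measurable_meanFn (hβ : Measurable fun u : R => β u) (ϑ : Param d p q) (t : ℕ) :
    Measurable fun u : R => meanFn r β ϑ t u :=
  (measurable_dotProduct_basis hβ _).add_const _

end Mean

/-! ### Expected loss, identifiability and decomposition of the likelihood -/

section Excess

variable {E : Type*} [MeasureSpace E] [SFinite (volume : Measure E)] {d p q : ℕ} [NeZero d] {r : ℕ} {R : Set E}
  {β : E → Fin p → ℝ}

theorem integrableOn_mul_comp_meanFn (hR : MeasurableSet R) (hr : 0 < r)
    (hβ : Measurable fun u : R => β u) (hβb : ∃ C : ℝ, ∀ u ∈ R, ∀ k, |β u k| ≤ C)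
    {g : E → ℝ} (hg : IntegrableOn g R) {ψ : ℝ → ℝ} (hψ : Continuous ψ) (ϑ : Param d p q)
    (t : ℕ) : IntegrableOn (fun u => g u * ψ (meanFn r β ϑ t u)) R := by
  obtain ⟨M, hM⟩ := exists_abs_meanFn_le hr hβb ϑ
  obtain ⟨D, hD⟩ := (isCompact_Icc (a := -M) (b := M)).exists_bound_of_continuousOn hψ.continuousOn
  refine Integrable.mul_bdd (c := D) hg (aemeasurable_restrict_of_subset hR le_rfl
    (g := fun u => ψ (meanFn r β ϑ t u)) (hψ.measurable.comp (measurable_meanFn hβ ϑ t))).aestronglyMeasurable ?_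
  exact (ae_restrict_mem hR).mono fun u hu => hD _ (abs_le.1 (hM t u hu))

/-- The mean function is linear in the parameter, so convexity of ψ passes through the integral. -/
theorem convexOn_integral_mul_comp_meanFn (hR : MeasurableSet R) (hr : 0 < r)
    (hβ : Measurable fun u : R => β u) (hβb : ∃ C : ℝ, ∀ u ∈ R, ∀ k, |β u k| ≤ C)
    {g : E → ℝ} (hg : IntegrableOn g R) (hg0 : ∀ u, 0 ≤ g u) {ψ : ℝ → ℝ} (hψ : Continuous ψ)
    (hψc : ConvexOn ℝ Set.univ ψ) (t : ℕ) :
    ConvexOn ℝ Set.univ fun ϑ : Param d p q => ∫ u in R, g u * ψ (meanFn r β ϑ t u) := by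
  refine ⟨convex_univ, fun ϑ _ ϑ' _ a b ha hb hab => ?_⟩
  have hi := fun ϑ : Param d p q => integrableOn_mul_comp_meanFn hR hr hβ hβb hg hψ ϑ t
  simp only [smul_eq_mul]
  rw [← integral_const_mul, ← integral_const_mul,
    ← integral_add ((hi ϑ).const_mul a) ((hi ϑ').const_mul b)]
  refine integral_mono (hi _) (((hi ϑ).const_mul a).add ((hi ϑ').const_mul b)) fun u => ?_
  simp only [meanFn_add, meanFn_smul]
  have := mul_le_mul_of_nonneg_left (hψc.2 (Set.mem_univ (meanFn r β ϑ t u))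
    (Set.mem_univ (meanFn r β ϑ' t u)) ha hb hab) (hg0 u)
  simp only [smul_eq_mul] at this
  linarith

/-- The loss in the `t`-th term of the expected working log-likelihood when the true parameter
`ϑ` is replaced by `ϑ + h`. -/
def excess (r : ℕ) (R : Set E) (β : E → Fin p → ℝ) (ϑ : Param d p q) (t : ℕ)
    (h : Param d p q) : ℝ :=
  ∫ u in R, Real.exp (meanFn r β ϑ t u) *
    (Real.exp (meanFn r β h t u) - (meanFn r β h t u + 1))

theorem excess_nonneg (ϑ h : Param d p q) (t : ℕ) : 0 ≤ excess r R β ϑ t h :=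
  integral_nonneg fun u =>
    mul_nonneg (Real.exp_pos _).le (sub_nonneg.2 (Real.add_one_le_exp _))

theorem excess_add_period (hdr : d ∣ r) (ϑ h : Param d p q) (t : ℕ) :
    excess r R β ϑ (t + r) h = excess r R β ϑ t h := by
  simp only [excess, meanFn_add_period hdr]

theorem convexOn_exp_sub_add_one : ConvexOn ℝ Set.univ fun x : ℝ => Real.exp x - (x + 1) :=
  convexOn_exp.sub ((concaveOn_id convex_univ).add_const 1)

variable (hR : MeasurableSet R) (hRfin : volume R < ⊤) (hr : 0 < r)
  (hβ : Measurable fun u : R => β u) (hβb : ∃ C : ℝ, ∀ u ∈ R, ∀ k, |β u k| ≤ C)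

include hR hRfin hr hβ hβb

theorem integrableOn_comp_meanFn {ψ : ℝ → ℝ} (hψ : Continuous ψ) (ϑ : Param d p q)
    (t : ℕ) : IntegrableOn (fun u => ψ (meanFn r β ϑ t u)) R := by
  simpa using integrableOn_mul_comp_meanFn hR hr hβ hβb
    (integrableOn_const (C := (1 : ℝ)) hRfin.ne) hψ ϑ t

theorem integrableOn_excess (ϑ h : Param d p q) (t : ℕ) :
    IntegrableOn (fun u => Real.exp (meanFn r β ϑ t u) *
      (Real.exp (meanFn r β h t u) - (meanFn r β h t u + 1))) R :=
  integrableOn_mul_comp_meanFn hR hr hβ hβb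
    (integrableOn_comp_meanFn hR hRfin hr hβ hβb Real.continuous_exp ϑ t)
    (ψ := fun x => Real.exp x - (x + 1)) (by fun_prop) h t

/-- Convexity is wanted for continuity in h, which is automatic for finite convex functions on a
finite-dimensional space. -/
theorem convexOn_excess (ϑ : Param d p q) (t : ℕ) :
    ConvexOn ℝ Set.univ (excess r R β ϑ t) :=
  convexOn_integral_mul_comp_meanFn hR hr hβ hβb
    (integrableOn_comp_meanFn hR hRfin hr hβ hβb Real.continuous_exp ϑ t)
    (fun u => (Real.exp_pos _).le) (ψ := fun x => Real.exp x - (x + 1)) (by fun_prop)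
    convexOn_exp_sub_add_one t

/-- The integrand is nonnegative, and exp x > x + 1 unless x = 0. -/
theorem ae_meanFn_eq_zero_of_excess_eq_zero {ϑ h : Param d p q} {t : ℕ}
    (h0 : excess r R β ϑ t h = 0) : ∀ᵐ u ∂volume.restrict R, meanFn r β h t u = 0 := by
  have := (integral_eq_zero_iff_of_nonneg (fun u => mul_nonneg (Real.exp_pos _).le
    (sub_nonneg.2 (Real.add_one_le_exp _)))
    (integrableOn_excess hR hRfin hr hβ hβb ϑ h t)).1 h0
  filter_upwards [this] with u hu
  by_contra hne
  have h1 := Real.add_one_lt_exp hne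
  have h2 := Real.exp_pos (meanFn r β ϑ t u)
  exact (mul_pos h2 (sub_pos.2 h1)).ne' hu

omit hR hRfin hr hβ hβb

/-- Identifiability of the trend-plus-seasonality model. -/
theorem eq_zero_of_ae_meanFn_eq_zero (hR0 : volume R ≠ 0)
    (hβi : ∀ a : Fin p → ℝ, (∀ᵐ u ∂volume.restrict R, a ⬝ᵥ β u = 0) → a = 0)
    (hdr : d ∣ r) (hqr : q < r)
    (hident : (∃ a : Fin p → ℝ, ∀ᵐ u ∂volume.restrict R, a ⬝ᵥ β u = 1) → q + d ≤ r)
    {h : Param d p q}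
    (h0 : ∀ t ∈ Finset.Icc 1 r, ∀ᵐ u ∂volume.restrict R, meanFn r β h t u = 0) : h = 0 := by
  have hd : 0 < d := Nat.pos_of_ne_zero (NeZero.ne d)
  have hdr' : d ≤ r := Nat.le_of_dvd (by omega) hdr
  have : NeBot (ae (volume.restrict R)) := by
    rw [ae_neBot]
    simpa using hR0
  have hc : ∀ t ∈ Finset.Icc 1 r, ∀ᵐ u ∂volume.restrict R,
      h.1 (season d t) ⬝ᵥ β u = -(h.2 ⬝ᵥ trendBasis q t) := by
    intro t ht
    filter_upwards [h0 t ht] with u hu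
    rw [meanFn, residue_of_mem ht] at hu
    linarith
  have hη : h.2 = 0 := by
    refine eq_zero_of_trendPoly_eq_zero ?_
    -- If the trend vanishes at all r times, degree at most q < r is enough. Otherwise a nonzero
    -- value of the trend is, up to sign, a linear combination of the basis; rescaling produces the
    -- constant 1, which makes q + d ≤ r available.
    by_cases hall : ∀ t ∈ Finset.Icc 1 r, h.2 ⬝ᵥ trendBasis q t = 0
    · refine polynomial_eq_zero_of_eval_nat_eq_zero ((natDegree_trendPoly_le h.2).trans_lt hqr)
        fun i hi => ?_
      rw [eval_trendPoly]
      have := hall (i + 1) (Finset.mem_Icc.2 ⟨by omega, by omega⟩)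
      push_cast at this
      exact this
    · push Not at hall
      obtain ⟨t, ht, hne⟩ := hall
      have hqd : q + d ≤ r := hident ⟨(-(h.2 ⬝ᵥ trendBasis q t))⁻¹ • h.1 (season d t), by
        filter_upwards [hc t ht] with u hu
        rw [smul_dotProduct, hu, smul_eq_mul, inv_mul_cancel₀ (neg_ne_zero.2 hne)]⟩
      refine polynomial_eq_zero_of_periodic (N := r - d) hd
        ((natDegree_trendPoly_le h.2).trans (by omega)) ?_ fun i hi => ?_
      · rw [eval_trendPoly]
        simp [dotProduct, trendBasis]
      · have hi1 : i + 1 ∈ Finset.Icc 1 r := Finset.mem_Icc.2 ⟨by omega, by omega⟩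
        have hi2 : i + 1 + d ∈ Finset.Icc 1 r := Finset.mem_Icc.2 ⟨by omega, by omega⟩
        -- Times i + 1 and i + 1 + d share a season. As R is not null, both almost-everywhere
        -- identities hold at a common u, so the trend takes equal values there.
        obtain ⟨u, hu1, hu2⟩ := ((hc _ hi1).and (hc _ hi2)).exists
        have hs : season d (i + 1 + d) = season d (i + 1) := Subtype.ext (residue_add_self _ _)
        rw [hs, hu1] at hu2
        rw [eval_trendPoly, eval_trendPoly]
        push_cast at hu2
        rw [show (i : ℝ) + d + 1 = i + 1 + d by ring]
        linarith
  have hθ : h.1 = 0 := by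
    funext j
    refine hβi _ ?_
    have hj := Finset.mem_Icc.1 j.2
    filter_upwards [hc j (Finset.mem_Icc.2 ⟨hj.1, hj.2.trans hdr'⟩)] with u hu
    rw [season_coe, hη, zero_dotProduct, neg_zero] at hu
    exact hu
  exact Prod.ext hθ hη

include hR hRfin hr hβ hβb

/-- The expected loss over a period is bounded away from zero on spheres. -/
theorem exists_pos_le_sum_excess (hR0 : volume R ≠ 0)
    (hβi : ∀ a : Fin p → ℝ, (∀ᵐ u ∂volume.restrict R, a ⬝ᵥ β u = 0) → a = 0)
    (hdr : d ∣ r) (hqr : q < r)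
    (hident : (∃ a : Fin p → ℝ, ∀ᵐ u ∂volume.restrict R, a ⬝ᵥ β u = 1) → q + d ≤ r)
    (ϑ : Param d p q) {ε : ℝ} (hε : 0 < ε) :
    ∃ δ : ℝ, 0 < δ ∧ ∀ h : Param d p q, ‖h‖ = ε →
      δ ≤ ∑ t ∈ Finset.Icc 1 r, excess r R β ϑ t h := by
  have hcont : ContinuousOn (fun h : Param d p q => ∑ t ∈ Finset.Icc 1 r, excess r R β ϑ t h)
      (Metric.sphere 0 ε) := by
    refine continuousOn_finsetSum _ fun t _ => ?_
    exact ((convexOn_excess hR hRfin hr hβ hβb ϑ t).continuousOn isOpen_univ).mono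
      (Set.subset_univ _)
  have hpos : ∀ h : Param d p q, ‖h‖ = ε → 0 < ∑ t ∈ Finset.Icc 1 r, excess r R β ϑ t h := by
    intro h hh
    refine (Finset.sum_nonneg fun t _ => excess_nonneg ϑ h t).lt_of_ne fun h0 => ?_
    have h1 := (Finset.sum_eq_zero_iff_of_nonneg fun t _ => excess_nonneg ϑ h t).1 h0.symm
    have : h = 0 := eq_zero_of_ae_meanFn_eq_zero hR0 hβi hdr hqr hident fun t ht =>
      ae_meanFn_eq_zero_of_excess_eq_zero hR hRfin hr hβ hβb (h1 t ht)
    rw [this, norm_zero] at hh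
    exact hε.ne hh
  by_cases hne : (Metric.sphere (0 : Param d p q) ε).Nonempty
  · obtain ⟨z, hz, hmin⟩ := (isCompact_sphere (0 : Param d p q) ε).exists_isMinOn hne hcont
    exact ⟨_, hpos z (by simpa using hz), fun h hh => hmin (by simpa using hh)⟩
  -- The sphere is empty when the parameter space is trivial.
  · exact ⟨1, one_pos, fun h hh => (hne ⟨h, by simpa using hh⟩).elim⟩

omit hR hRfin hr hβ hβb

/-- The working log-likelihood in terms of the mean function. -/
theorem rho_eq (n : ℕ) (x : ℕ → Finset E) (ϑ : Param d p q) :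
    rho r R β n x ϑ = (1 / (n : ℝ)) * ∑ t ∈ Finset.Icc 1 n,
      ((∑ u ∈ x t, meanFn r β ϑ t u) - ∫ u in R, Real.exp (meanFn r β ϑ t u)) := by
  have h1 : ∀ t, ∫ u in R, Real.exp (meanFn r β ϑ t u) =
      Real.exp (ϑ.2 ⬝ᵥ trendBasis q (residue r t)) *
      ∫ u in R, Real.exp (ϑ.1 (season d t) ⬝ᵥ β u) := by
    intro t
    rw [← integral_const_mul]
    refine integral_congr_ae (.of_forall fun u => ?_)
    simp only [meanFn]
    rw [add_comm, Real.exp_add]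
  have h2 : ∀ t, ∑ u ∈ x t, meanFn r β ϑ t u =
      ∑ u ∈ x t, (ϑ.1 (season d t) ⬝ᵥ β u) +
        ((x t).card : ℝ) * (ϑ.2 ⬝ᵥ trendBasis q (residue r t)) := by
    intro t
    simp only [meanFn]
    rw [Finset.sum_add_distrib, Finset.sum_const, nsmul_eq_mul]
  simp_rw [h1, h2]
  rw [rho, Finset.sum_sub_distrib, Finset.sum_add_distrib]
  ring

/-- The centred linear part of the working log-likelihood. -/
def noise (r : ℕ) (R : Set E) (β : E → Fin p → ℝ) (ϑ : Param d p q) (n : ℕ) (x : ℕ → Finset E)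
    (h : Param d p q) : ℝ :=
  (1 / (n : ℝ)) * ∑ t ∈ Finset.Icc 1 n, ((∑ u ∈ x t, meanFn r β h t u) -
    ∫ u in R, meanFn r β h t u * Real.exp (meanFn r β ϑ t u))

include hR hRfin hr hβ hβb

/-- Each term is linear in the parameter minus a convex integral of an exponential. -/
theorem concaveOn_rho (n : ℕ) (x : ℕ → Finset E) :
    ConcaveOn ℝ Set.univ (rho (d := d) (p := p) (q := q) r R β n x) := by
  have hconv : ∀ t, ConvexOn ℝ Set.univ
      fun ϑ : Param d p q => ∫ u in R, Real.exp (meanFn r β ϑ t u) := fun t => by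
    simpa using convexOn_integral_mul_comp_meanFn hR hr hβ hβb
      (integrableOn_const (C := (1 : ℝ)) hRfin.ne) (fun _ => zero_le_one) Real.continuous_exp
      convexOn_exp t
  refine ⟨convex_univ, fun ϑ _ ϑ' _ a b ha hb hab => ?_⟩
  simp only [rho_eq, smul_eq_mul]
  rw [mul_left_comm a, mul_left_comm b, ← mul_add]
  refine mul_le_mul_of_nonneg_left ?_ (by positivity)
  rw [Finset.mul_sum, Finset.mul_sum, ← Finset.sum_add_distrib]
  refine Finset.sum_le_sum fun t _ => ?_
  have h1 := (hconv t).2 (Set.mem_univ ϑ) (Set.mem_univ ϑ') ha hb hab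
  simp only [smul_eq_mul] at h1
  have h2 : ∑ u ∈ x t, meanFn r β (a • ϑ + b • ϑ') t u =
      a * ∑ u ∈ x t, meanFn r β ϑ t u + b * ∑ u ∈ x t, meanFn r β ϑ' t u := by
    simp only [meanFn_add, meanFn_smul]
    rw [Finset.sum_add_distrib, Finset.mul_sum, Finset.mul_sum]
  rw [h2]
  linarith

/-- An identity for every ϑ and every point pattern. The noise has mean zero only when exp of the
mean function of ϑ is the true mean intensity. -/
theorem rho_add_sub_rho (n : ℕ) (x : ℕ → Finset E) (ϑ h : Param d p q) :
    rho r R β n x (ϑ + h) - rho r R β n x ϑ =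
      noise r R β ϑ n x h - (1 / (n : ℝ)) * ∑ t ∈ Finset.Icc 1 n, excess r R β ϑ t h := by
  rw [rho_eq, rho_eq, noise, ← mul_sub, ← mul_sub, ← Finset.sum_sub_distrib,
    ← Finset.sum_sub_distrib]
  congr 1
  refine Finset.sum_congr rfl fun t _ => ?_
  have hexp := integrableOn_comp_meanFn hR hRfin hr hβ hβb Real.continuous_exp
    (d := d) (q := q)
  -- With a and b the mean functions of ϑ and h: exp(a + b) = exp a * (exp b - b - 1) + b * exp a +
  -- exp a.
  have h1 : ∫ u in R, Real.exp (meanFn r β (ϑ + h) t u) =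
      excess r R β ϑ t h + (∫ u in R, meanFn r β h t u * Real.exp (meanFn r β ϑ t u)) +
        ∫ u in R, Real.exp (meanFn r β ϑ t u) := by
    have hi : IntegrableOn (fun u => meanFn r β h t u * Real.exp (meanFn r β ϑ t u)) R :=
      (integrableOn_mul_comp_meanFn hR hr hβ hβb (hexp ϑ t) continuous_id h t).congr
        (.of_forall fun u => mul_comm _ _)
    have hsum : IntegrableOn (fun u => Real.exp (meanFn r β ϑ t u) *
        (Real.exp (meanFn r β h t u) - (meanFn r β h t u + 1)) +
          meanFn r β h t u * Real.exp (meanFn r β ϑ t u)) R :=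
      (integrableOn_excess hR hRfin hr hβ hβb ϑ h t).add hi
    rw [excess, ← integral_add (integrableOn_excess hR hRfin hr hβ hβb ϑ h t) hi,
      ← integral_add hsum (hexp ϑ t)]
    refine integral_congr_ae (.of_forall fun u => ?_)
    simp only [meanFn_add, Real.exp_add]
    ring
  rw [h1]
  simp only [meanFn_add, Finset.sum_add_distrib]
  ring

end Excess

/-! ### The noise as a linear form with finitely many coefficients -/

section Noise

variable {E : Type*} [MeasureSpace E] [SFinite (volume : Measure E)] {d p q : ℕ} [NeZero d]
  {r : ℕ} {R : Set E} {β : E → Fin p → ℝ}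

/-- The weighted average of the centred sums of `φ` over the points. -/
def centredAverage (r : ℕ) (R : Set E) (β : E → Fin p → ℝ) (ϑ : Param d p q) (w : ℕ → ℝ)
    (φ : E → ℝ) (n : ℕ) (x : ℕ → Finset E) : ℝ :=
  (1 / (n : ℝ)) * ∑ t ∈ Finset.Icc 1 n,
    w t * ((∑ u ∈ x t, φ u) - ∫ u in R, φ u * Real.exp (meanFn r β ϑ t u))

/-- Separating h from the data reduces control of the noise on a whole sphere to one weak law per
coordinate of the parameter. -/
theorem noise_eq (hR : MeasurableSet R) (hRfin : volume R < ⊤) (hr : 0 < r)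
    (hβ : Measurable fun u : R => β u) (hβb : ∃ C : ℝ, ∀ u ∈ R, ∀ k, |β u k| ≤ C)
    (ϑ : Param d p q) (n : ℕ) (x : ℕ → Finset E) (h : Param d p q) :
    noise r R β ϑ n x h =
      (∑ j, ∑ k, h.1 j k * centredAverage r R β ϑ (fun t => if season d t = j then 1 else 0)
        (fun u => β u k) n x) +
      ∑ k, h.2 k * centredAverage r R β ϑ (fun t => trendBasis q (residue r t) k)
        (fun _ => 1) n x := by
  have hterm : ∀ t, (∑ u ∈ x t, meanFn r β h t u) -
      ∫ u in R, meanFn r β h t u * Real.exp (meanFn r β ϑ t u) =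
      (∑ j, ∑ k, h.1 j k * ((if season d t = j then (1 : ℝ) else 0) *
        ((∑ u ∈ x t, β u k) - ∫ u in R, β u k * Real.exp (meanFn r β ϑ t u)))) +
      ∑ k, h.2 k * (trendBasis q (residue r t) k *
        ((∑ u ∈ x t, (1 : ℝ)) - ∫ u in R, (1 : ℝ) * Real.exp (meanFn r β ϑ t u))) := by
    intro t
    have hexp : IntegrableOn (fun u => Real.exp (meanFn r β ϑ t u)) R :=
      integrableOn_comp_meanFn hR hRfin hr hβ hβb Real.continuous_exp ϑ t
    have hβexp : ∀ k, IntegrableOn (fun u => β u k * Real.exp (meanFn r β ϑ t u)) R := by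
      intro k
      obtain ⟨C, hC⟩ := hβb
      exact Integrable.bdd_mul (c := C) hexp (aemeasurable_restrict_of_subset hR le_rfl
        (g := fun u => β u k) ((measurable_pi_iff.1 hβ) k)).aestronglyMeasurable
        ((ae_restrict_mem hR).mono fun u hu => hC u hu k)
    have h1 : ∑ u ∈ x t, meanFn r β h t u =
        (∑ k, h.1 (season d t) k * ∑ u ∈ x t, β u k) +
          (h.2 ⬝ᵥ trendBasis q (residue r t)) * ∑ u ∈ x t, (1 : ℝ) := by
      simp only [meanFn]
      rw [Finset.sum_add_distrib, Finset.mul_sum]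
      simp only [dotProduct, mul_one, Finset.mul_sum]
      rw [Finset.sum_comm]
    have h2 : ∫ u in R, meanFn r β h t u * Real.exp (meanFn r β ϑ t u) =
        (∑ k, h.1 (season d t) k * ∫ u in R, β u k * Real.exp (meanFn r β ϑ t u)) +
          (h.2 ⬝ᵥ trendBasis q (residue r t)) *
            ∫ u in R, (1 : ℝ) * Real.exp (meanFn r β ϑ t u) := by
      simp_rw [← integral_const_mul, one_mul]
      rw [← integral_finsetSum _ fun k _ => (hβexp k).const_mul _,
        ← integral_add (integrable_finsetSum _ fun k _ => (hβexp k).const_mul _)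
          (hexp.const_mul _)]
      refine integral_congr_ae (.of_forall fun u => ?_)
      simp only [meanFn, dotProduct]
      rw [add_mul, Finset.sum_mul]
      simp only [mul_assoc]
    have h3 : ∀ S : Fin p → ℝ, ∑ j, ∑ k, h.1 j k *
        ((if season d t = j then (1 : ℝ) else 0) * S k) = ∑ k, h.1 (season d t) k * S k := by
      intro S
      rw [Finset.sum_comm]
      simp
    rw [h1, h2, h3]
    simp only [mul_sub, Finset.sum_sub_distrib, dotProduct, Finset.sum_mul, mul_assoc]
    ring
  simp only [noise, centredAverage, hterm]
  rw [Finset.sum_add_distrib, mul_add]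
  congr 1
  · simp only [Finset.mul_sum]
    rw [Finset.sum_comm]
    refine Finset.sum_congr rfl fun j _ => ?_
    rw [Finset.sum_comm]
    refine Finset.sum_congr rfl fun k _ => Finset.sum_congr rfl fun t _ => by ring
  · simp only [Finset.mul_sum]
    rw [Finset.sum_comm]
    refine Finset.sum_congr rfl fun k _ => Finset.sum_congr rfl fun t _ => by ring

/-- The sum of the absolute values of the coefficients of the linear map `noise`. -/
def noiseSize (r : ℕ) (R : Set E) (β : E → Fin p → ℝ) (ϑ : Param d p q) (n : ℕ)
    (x : ℕ → Finset E) : ℝ :=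
  (∑ j, ∑ k, |centredAverage r R β ϑ (fun t => if season d t = j then 1 else 0)
        (fun u => β u k) n x|) +
      ∑ k, |centredAverage r R β ϑ (fun t => trendBasis q (residue r t) k) (fun _ => 1) n x|

theorem noise_le (hR : MeasurableSet R) (hRfin : volume R < ⊤) (hr : 0 < r)
    (hβ : Measurable fun u : R => β u) (hβb : ∃ C : ℝ, ∀ u ∈ R, ∀ k, |β u k| ≤ C)
    (ϑ : Param d p q) (n : ℕ) (x : ℕ → Finset E) (h : Param d p q) :
    noise r R β ϑ n x h ≤ ‖h‖ * noiseSize r R β ϑ n x := by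
  rw [noise_eq hR hRfin hr hβ hβb, noiseSize, mul_add, Finset.mul_sum, Finset.mul_sum]
  refine add_le_add (Finset.sum_le_sum fun j _ => ?_) (Finset.sum_le_sum fun k _ => ?_)
  · rw [Finset.mul_sum]
    refine Finset.sum_le_sum fun k _ => (le_abs_self _).trans ?_
    rw [abs_mul]
    gcongr
    exact (norm_le_pi_norm (h.1 j) k).trans ((norm_le_pi_norm h.1 j).trans (norm_fst_le h))
  · refine (le_abs_self _).trans ?_
    rw [abs_mul]
    gcongr
    exact (norm_le_pi_norm h.2 k).trans (norm_snd_le h)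

end Noise

/-! ### Consistency of M-estimators -/

section Consistency

variable {Ω : Type*} [MeasurableSpace Ω] {P : Measure Ω}

theorem tendstoInMeasure_zero_abs {f : ℕ → Ω → ℝ}
    (hf : TendstoInMeasure P f atTop fun _ => 0) :
    TendstoInMeasure P (fun n ω => |f n ω|) atTop fun _ => 0 :=
  tendstoInMeasure_zero_of_forall_subset fun _ hδ =>
    ⟨_, tendsto_measure_of_tendstoInMeasure_zero hf hδ, .of_forall fun n ω hω => by simpa using hω⟩

/-- Continuous functions preserve convergence in measure to a constant. -/
theorem tendstoInMeasure_comp_of_continuousAt {V W : Type*} [PseudoMetricSpace V]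
    [PseudoMetricSpace W] {Z : ℕ → Ω → V} {z : V}
    (hZ : TendstoInMeasure P Z atTop fun _ => z) {f : V → W} (hf : ContinuousAt f z) :
    TendstoInMeasure P (fun n ω => f (Z n ω)) atTop fun _ => f z := by
  rw [tendstoInMeasure_iff_dist] at hZ ⊢
  intro ε hε
  obtain ⟨δ, hδ, h⟩ := Metric.continuousAt_iff.1 hf ε hε
  refine tendsto_of_tendsto_of_tendsto_of_le_of_le tendsto_const_nhds (hZ δ hδ)
    (fun _ => zero_le) fun n => measure_mono fun ω hω => ?_
  simp only [Set.mem_ofPred_eq] at hω ⊢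
  by_contra! hlt
  exact (h hlt).not_ge hω

variable {E : Type*} [MeasureSpace E] [SFinite (volume : Measure E)] {d p q : ℕ} [NeZero d]
  {r : ℕ} {R : Set E} {β : E → Fin p → ℝ} {X : ℕ → Ω → Finset E}

/-- An M-estimator is consistent if the coefficients of the noise vanish in measure. -/
theorem IsMEstimator.tendstoInMeasure (hR : MeasurableSet R) (hRfin : volume R < ⊤)
    (hR0 : volume R ≠ 0)
    (hβ : Measurable fun u : R => β u) (hβb : ∃ C : ℝ, ∀ u ∈ R, ∀ k, |β u k| ≤ C)
    (hβi : ∀ a : Fin p → ℝ, (∀ᵐ u ∂volume.restrict R, a ⬝ᵥ β u = 0) → a = 0)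
    (hdr : d ∣ r) (hqr : q < r)
    (hident : (∃ a : Fin p → ℝ, ∀ᵐ u ∂volume.restrict R, a ⬝ᵥ β u = 1) → q + d ≤ r)
    {est : ℕ → Ω → Param d p q} (hest : IsMEstimator r R β X est) (ϑ : Param d p q)
    (hnoise : TendstoInMeasure P (fun n ω => noiseSize r R β ϑ n fun t => X t ω) atTop
      fun _ => 0) :
    TendstoInMeasure P est atTop fun _ => ϑ := by
  have hr : 0 < r := by omega
  have hr0 : (0 : ℝ) < r := by exact_mod_cast hr
  rw [tendstoInMeasure_iff_norm]
  intro ε hε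
  obtain ⟨δ, hδ, hlow⟩ := exists_pos_le_sum_excess hR hRfin hr hβ hβb hR0 hβi hdr hqr hident ϑ hε
  -- On the ε-sphere the noise is at most ε times its size, and εκ = δ/(2r) is the lower bound for
  -- the average excess once n ≥ r.
  set κ := (1 / (2 * r : ℝ)) * δ / ε with hκ
  have hκ0 : 0 < κ := by positivity
  refine tendsto_of_tendsto_of_tendsto_of_le_of_le' tendsto_const_nhds
    (tendsto_measure_of_tendstoInMeasure_zero hnoise hκ0) (.of_forall fun _ => zero_le) ?_
  filter_upwards [eventually_ge_atTop r] with n hn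
  refine measure_mono fun ω hω => ?_
  simp only [Set.mem_ofPred_eq] at hω ⊢
  by_contra! hlt
  refine hω.not_gt ?_
  have hconc := concaveOn_rho (d := d) (q := q) hR hRfin hr hβ hβb n fun t => X t ω
  have hsphere : ∀ h : Param d p q, ‖h‖ = ε →
      rho r R β n (fun t => X t ω) (ϑ + h) < rho r R β n (fun t => X t ω) ϑ := by
    intro h hh
    rw [← sub_neg, rho_add_sub_rho hR hRfin hr hβ hβb]
    have h1 := noise_le hR hRfin hr hβ hβb ϑ n (fun t => X t ω) h
    have h2 := le_average_of_periodic hr (fun t => excess_add_period (R := R) (β := β) hdr ϑ h t)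
      (fun t => excess_nonneg ϑ h t) hn
    have h3 := mul_le_mul_of_nonneg_left (hlow h hh) (by positivity : (0 : ℝ) ≤ 1 / (2 * r))
    rw [hh] at h1
    have h4 : ε * noiseSize r R β ϑ n (fun t => X t ω) < ε * κ :=
      mul_lt_mul_of_pos_left ((le_abs_self _).trans_lt hlt) hε
    have h5 : ε * κ = (1 / (2 * r : ℝ)) * δ := by rw [hκ]; field_simp
    linarith
  exact norm_sub_lt_of_isMaxOn hconc hε hsphere
    (hest n (by omega) ω (exists_isMaxOn_of_lt_on_sphere hconc hε hsphere))

/-- Each coefficient falls under the weak law, because the mean intensity is exactly exp of the mean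
function of ϑ and the weights are bounded. -/
theorem IsLogGaussianCoxSeries.tendstoInMeasure_noiseSize [IsProbabilityMeasure P]
    {m : ℕ → E → ℝ} {Y : ℕ → E → Ω → ℝ} {γ : ℕ → E → E → ℝ} {L V : ℝ} {ϑ : Param d p q}
    (h : IsLogGaussianCoxSeries P R m Y γ X (fun t u => Real.exp (meanFn r β ϑ t u)) L V)
    (hr : 0 < r) (hβ : Measurable fun u : R => β u)
    (hβb : ∃ C : ℝ, ∀ u ∈ R, ∀ k, |β u k| ≤ C) :
    TendstoInMeasure P (fun n ω => noiseSize r R β ϑ n fun t => X t ω) atTop fun _ => 0 := by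
  obtain ⟨C, hC⟩ := hβb
  refine tendstoInMeasure_zero_add (tendstoInMeasure_zero_sum _ fun j _ =>
    tendstoInMeasure_zero_sum _ fun k _ => tendstoInMeasure_zero_abs ?_)
    (tendstoInMeasure_zero_sum _ fun k _ => tendstoInMeasure_zero_abs ?_)
  · exact h.tendstoInMeasure_sum (φ := fun u => β u k) ((measurable_pi_iff.1 hβ) k)
      (fun u hu => hC u hu k) (w := fun t => if season d t = j then 1 else 0) (W := 1)
      fun t => by split_ifs <;> simp
  · exact h.tendstoInMeasure_sum (φ := fun _ => 1) measurable_const (C := 1) (by simp)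
      (w := fun t => trendBasis q (residue r t) k) fun t => abs_trendBasis_residue_le hr t k

end Consistency

end PointSeries

end

/-! ### The limit of the estimators -/

theorem theorem1 {Ω : Type*} [MeasurableSpace Ω] (P : Measure Ω) [IsProbabilityMeasure P]
    -- the region `R` in `ℝ^s`
    {s : ℕ} (hs : 1 ≤ s) (R : Set (EuclideanSpace ℝ (Fin s)))
    (hR : MeasurableSet R) (hRb : Bornology.IsBounded R) (hR0 : volume R ≠ 0)
    -- the basis functions: bounded, measurable, linearly independent modulo null sets
    {p : ℕ} (β : EuclideanSpace ℝ (Fin s) → Fin p → ℝ)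
    (hβ : Measurable fun u : R => β u) (hβb : ∃ C : ℝ, ∀ u ∈ R, ∀ k, |β u k| ≤ C)
    (hβi : ∀ a : Fin p → ℝ, (∀ᵐ u ∂volume.restrict R, a ⬝ᵥ β u = 0) → a = 0)
    -- the seasonal period `d`, the trend period `r`, and the number `q` of trend coefficients
    (d r q : ℕ) [NeZero d] (hdr : d ∣ r) (hqr : q < r)
    (hident : (∃ a : Fin p → ℝ, ∀ᵐ u ∂volume.restrict R, a ⬝ᵥ β u = 1) → q + d ≤ r)
    -- the true parameters, the latent Gaussian processes and the observed point processes
    (θ₀ : PointSeries.Season d → Fin p → ℝ) (η₀ : Fin q → ℝ)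
    (Y : ℕ → EuclideanSpace ℝ (Fin s) → Ω → ℝ)
    (γ : ℕ → EuclideanSpace ℝ (Fin s) → EuclideanSpace ℝ (Fin s) → ℝ)
    (X : ℕ → Ω → Finset (EuclideanSpace ℝ (Fin s)))
    (hX : PointSeries.IsCoxSeries P R (PointSeries.intensity r β (θ₀, η₀) Y) X)
    (hY : PointSeries.IsStationaryGaussianSeries P R Y γ)
    (v₀ : EuclideanSpace ℝ (Fin s) → ℝ)
    (hv : ∀ t, 1 ≤ t → ∀ u ∈ R, Var[Y t u; P] = v₀ u)
    (τ₀ : Fin p → ℝ) (hτ : ∀ u ∈ R, v₀ u = τ₀ ⬝ᵥ β u)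
    (hγ : TendstoUniformlyOn (fun k (z : EuclideanSpace ℝ (Fin s) × EuclideanSpace ℝ (Fin s)) =>
      γ k z.1 z.2) 0 atTop (R ×ˢ R))
    -- the estimators
    (θhat : ℕ → Ω → PointSeries.Season d → Fin p → ℝ) (ηhat : ℕ → Ω → Fin q → ℝ)
    (hest : PointSeries.IsMEstimator r R β X fun n ω => (θhat n ω, ηhat n ω)) :
    TendstoInMeasure P ηhat atTop (fun _ => η₀) ∧
    (∀ j, TendstoInMeasure P (fun n ω => θhat n ω j) atTop
      (fun _ => θ₀ j + (1 / 2 : ℝ) • τ₀)) ∧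
    (∀ t ∈ Set.Icc (1 : ℝ) r,
      TendstoInMeasure P (fun n ω => ηhat n ω ⬝ᵥ PointSeries.trendBasis q t) atTop
        (fun _ => η₀ ⬝ᵥ PointSeries.trendBasis q t)) ∧
    (∀ j, ∀ u ∈ R,
      TendstoInMeasure P (fun n ω => Real.exp (θhat n ω j ⬝ᵥ β u)) atTop
        (fun _ => Real.exp (θ₀ j ⬝ᵥ β u + v₀ u / 2))) := by
  obtain ⟨C, hC⟩ := hβb
  have hβb : ∃ C : ℝ, ∀ u ∈ R, ∀ k, |β u k| ≤ C := ⟨C, hC⟩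
  have hr : 0 < r := by omega
  have hRfin : volume R < ⊤ := hRb.measure_lt_top
  -- The parameter of the mean intensity: half the variance function τ₀ᵀβ is absorbed into every
  -- seasonal coefficient vector, and the trend is unchanged.
  let ϑs : PointSeries.Param d p q := (fun j => θ₀ j + (1 / 2 : ℝ) • τ₀, η₀)
  obtain ⟨M, hM⟩ := PointSeries.exists_abs_meanFn_le (q := q) hr hβb ϑs
  have hlam : ∀ t, 1 ≤ t → ∀ u ∈ R, Real.exp (PointSeries.meanFn r β ϑs t u) =
      Real.exp (PointSeries.meanFn r β (θ₀, η₀) t u + Var[Y t u; P] / 2) := by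
    intro t ht u hu
    rw [hv t ht u hu, hτ u hu]
    congr 1
    simp only [PointSeries.meanFn, ϑs, add_dotProduct, smul_dotProduct, smul_eq_mul]
    ring
  have hcox : PointSeries.IsLogGaussianCoxSeries P R (PointSeries.meanFn r β (θ₀, η₀)) Y γ X
      (fun t u => Real.exp (PointSeries.meanFn r β ϑs t u)) (Real.exp M)
      (‖τ₀‖ * ∑ _k : Fin p, C) :=
    { measurableSet := hR
      volume_lt_top := hRfin
      cox := hX
      gaussian := hY
      measurable_mean := PointSeries.measurable_meanFn hβ _
      measurable_lam := fun t => (PointSeries.measurable_meanFn hβ ϑs t).exp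
      lam_nonneg := fun t u => (Real.exp_pos _).le
      lam_le := fun t _ u hu => Real.exp_le_exp.2 ((le_abs_self _).trans (hM t u hu))
      variance_le := fun t ht u hu => by
        rw [hv t ht u hu, hτ u hu]
        exact (le_abs_self _).trans (PointSeries.abs_dotProduct_le _ _ (hC u hu))
      lam_eq := hlam
      autocov_tendsto := hγ }
  have hmain : TendstoInMeasure P (fun n ω => ((θhat n ω, ηhat n ω) : PointSeries.Param d p q))
      atTop fun _ => ϑs :=
    hest.tendstoInMeasure hR hRfin hR0 hβ hβb hβi hdr hqr hident ϑs
      (hcox.tendstoInMeasure_noiseSize hr hβ hβb)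
  -- Each conclusion is the image of the joint convergence under a continuous map of the parameter.
  have hcomp : ∀ {W : Type} [PseudoMetricSpace W] (f : PointSeries.Param d p q → W),
      Continuous f → TendstoInMeasure P (fun n ω => f (θhat n ω, ηhat n ω)) atTop
        fun _ => f ϑs := fun f hf =>
    PointSeries.tendstoInMeasure_comp_of_continuousAt hmain hf.continuousAt
  refine ⟨hcomp (fun ϑ => ϑ.2) continuous_snd, fun j => hcomp (fun ϑ => ϑ.1 j) (by fun_prop),
    fun t _ => hcomp (fun ϑ => ϑ.2 ⬝ᵥ PointSeries.trendBasis q t) ?_, fun j u hu => ?_⟩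
  · simp only [dotProduct]
    fun_prop
  · have h := hcomp (fun ϑ => Real.exp (ϑ.1 j ⬝ᵥ β u)) (by simp only [dotProduct]; fun_prop)
    have hval : ϑs.1 j ⬝ᵥ β u = θ₀ j ⬝ᵥ β u + v₀ u / 2 := by
      rw [hτ u hu]
      simp only [ϑs, add_dotProduct, smul_dotProduct, smul_eq_mul]
      ring
    simpa only [hval] using h
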